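/- Let $M$ be a smooth oriented Riemannian 3-manifold with (possibly empty) boundary $\partial M$, with Riemannian volume form $\mu$. For a smooth vector field $X$ on $M$, the divergence $\nabla\cdot X$ and the curl $\nabla\times X$ are defined by $d(\iota_X\mu)=(\nabla\cdot X)\,\mu$ and $\iota_{\nabla\times X}\,\mu=d(X^\flat)$, and a first integral of $X$ is a function $\rho\in C^\infty(M)$ with $X(\rho)=d\rho(X)=0$ on $M$. Let $B$ be a smooth vector field on $M$ with $\nabla\cdot B=0$, and let $\rho\in C^\infty(M)$ be a first integral both of $B$ and of $\nabla\times B$. Let $c\in\mathbb{R}$ be such that $d\rho$ vanishes at no point of the level set $\rho^{-1}(c)$, and let $S$ be a connected component of $\rho^{-1}(c)$ which is (as an embedded submanifold of $M$) diffeomorphic to the sphere $\mathbb{S}^2$. Assume that $S\cap\partial M=\emptyset$ or $S\subseteq\partial M$. Then there is an open neighbourhood $U$ of $S$ in $M$ such that $B=0$ on $U$. -/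

import Mathlib

open scoped Manifold ContDiff Topology

noncomputable section

namespace Riem3

/-- The model vector space `ℝ³`. -/
abbrev E3 : Type := EuclideanSpace ℝ (Fin 3)

section Pointwise

variable {V : Type*} [AddCommGroup V] [Module ℝ V] [TopologicalSpace V]

/-- The interior product `ι_X α = α(X, ·, …, ·)` of a vector and an alternating form. -/
def interiorProduct {k : ℕ} (X : V) (α : V [⋀^Fin (k + 1)]→L[ℝ] ℝ) : V [⋀^Fin k]→L[ℝ] ℝ :=
  { α.toAlternatingMap.curryLeft X with
    cont := by
      have h : Continuous fun v : Fin k → V => α (Fin.cons X v) :=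
        α.cont.comp (continuous_const.finCons continuous_id)
      exact h }

end Pointwise

section Manifold

variable {M : Type*} [TopologicalSpace M] [ChartedSpace (EuclideanHalfSpace 3) M]

/-- The tangent space of a 3-manifold with boundary `M` at `x`. -/
abbrev T (x : M) : Type := TangentSpace (𝓡∂ 3) x

/-- A vector field on `M` is smooth if it is smooth as a section of the tangent bundle. -/
def IsSmoothField (X : ∀ x : M, T x) [IsManifold (𝓡∂ 3) ∞ M] : Prop :=
  ContMDiff (𝓡∂ 3) (𝓡∂ 3).tangent ∞ (fun x => (⟨x, X x⟩ : TangentBundle (𝓡∂ 3) M))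

variable (M) in
/-- A smooth Riemannian metric on `M`. -/
abbrev RiemMetric [IsManifold (𝓡∂ 3) ∞ M] : Type _ :=
  Bundle.ContMDiffRiemannianMetric (𝓡∂ 3) ∞ E3 (fun x : M => T x)

variable (M) in
/-- An orientation of `M`: an orientation of every tangent space which is continuous, that is,
around every point it is the orientation given by a smooth local frame. -/
structure MfdOrientation [IsManifold (𝓡∂ 3) ∞ M] where
  /-- the orientation of the tangent space at a point -/
  orient : ∀ x : M, Orientation ℝ (T x) (Fin 3)
  exists_frame : ∀ x₀ : M, ∃ X : Fin 3 → ∀ x : M, T x,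
    (∀ i, ContMDiffAt (𝓡∂ 3) (𝓡∂ 3).tangent ∞
      (fun x => (⟨x, X i x⟩ : TangentBundle (𝓡∂ 3) M)) x₀) ∧
    ∀ᶠ x in 𝓝 x₀, ∃ b : Module.Basis (Fin 3) ℝ (T x),
      (∀ i, b i = X i x) ∧ b.orientation = orient x

/-- The expression of a differential `k`-form in the preferred chart at `p`: its pullback by
the inverse of the chart. -/
def chartForm {k : ℕ} (α : ∀ x : M, T x [⋀^Fin k]→L[ℝ] ℝ) (p : M) (y : E3) :
    E3 [⋀^Fin k]→L[ℝ] ℝ :=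
  (α ((extChartAt (𝓡∂ 3) p).symm y)).compContinuousLinearMap
    (mfderivWithin 𝓘(ℝ, E3) (𝓡∂ 3) (extChartAt (𝓡∂ 3) p).symm (Set.range (𝓡∂ 3)) y :)

/-- The exterior derivative `dα` of a differential form on `M`: at `p` it is computed in the
chart at `p` and pulled back to `M` by that chart. -/
def extDerivForm {k : ℕ} (α : ∀ x : M, T x [⋀^Fin k]→L[ℝ] ℝ) (p : M) :
    T p [⋀^Fin (k + 1)]→L[ℝ] ℝ :=
  (extDerivWithin (chartForm α p) (Set.range (𝓡∂ 3))
    (extChartAt (𝓡∂ 3) p p)).compContinuousLinearMap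
      (mfderiv (𝓡∂ 3) 𝓘(ℝ, E3) (extChartAt (𝓡∂ 3) p) p :)

variable [IsManifold (𝓡∂ 3) ∞ M]

/-- The one-form `X♭ = g(X, ·)` of a vector field. -/
def flat (g : RiemMetric M) (X : ∀ x : M, T x) (x : M) : T x [⋀^Fin 1]→L[ℝ] ℝ :=
  ContinuousAlternatingMap.ofSubsingleton ℝ (T x) ℝ (0 : Fin 1) (g.inner x (X x))

/-- A positively oriented basis of the tangent space at `x`. -/
def orientedBasis (o : MfdOrientation M) (x : M) : Module.Basis (Fin 3) ℝ (T x) :=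
  Module.Basis.adjustToOrientation
    (show Module.Basis (Fin 3) ℝ (T x) from (EuclideanSpace.basisFun (Fin 3) ℝ).toBasis)
    (o.orient x)

/-- The volume `√(det g(bᵢ, bⱼ))` of the parallelepiped spanned by the vectors `bᵢ` of
`orientedBasis o x`. -/
def gramVolume (g : RiemMetric M) (o : MfdOrientation M) (x : M) : ℝ :=
  √(Matrix.of fun i j => g.inner x (orientedBasis o x i) (orientedBasis o x j)).det

/-- The Riemannian volume form of the oriented Riemannian 3-manifold `(M, g, o)`:
`√(det g(bᵢ, bⱼ)) b¹ ∧ b² ∧ b³` for a positively oriented basis `b` with dual basis `bⁱ`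
(this does not depend on the basis). -/
def volForm (g : RiemMetric M) (o : MfdOrientation M) (x : M) : T x [⋀^Fin 3]→L[ℝ] ℝ :=
  { gramVolume g o x • (orientedBasis o x).det with
    cont := by
      have h : Continuous fun v : Fin 3 → T x =>
          gramVolume g o x • ((orientedBasis o x).toMatrix v).det := by
        have : FiniteDimensional ℝ (T x) := inferInstanceAs (FiniteDimensional ℝ E3)
        have : T2Space (T x) := inferInstanceAs (T2Space E3)
        have hm : Continuous fun v : Fin 3 → T x => (orientedBasis o x).toMatrix v :=
          continuous_matrix fun i j =>
            ((orientedBasis o x).coord i).continuous_of_finiteDimensional.comp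
              (continuous_apply j)
        exact hm.matrix_det.const_smul (gramVolume g o x)
      exact h }

/-- The divergence `∇ · X` of a vector field, defined by `d(ι_X vol) = (∇ · X) vol`. -/
def divergence (g : RiemMetric M) (o : MfdOrientation M) (X : ∀ x : M, T x) (x : M) : ℝ :=
  extDerivForm (fun y => interiorProduct (X y) (volForm g o y)) x (orientedBasis o x) /
    volForm g o x (orientedBasis o x)

/-- The curl `∇ × X` of a vector field: the vector field `C` with `ι_C vol = d(X♭)`, that is,
`C♭ = ⋆ d(X♭)`. The indices are cyclic, in `ℤ/3`. -/
def curl (g : RiemMetric M) (o : MfdOrientation M) (X : ∀ x : M, T x) (x : M) : T x :=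
  (gramVolume g o x)⁻¹ • ∑ i : Fin 3,
    extDerivForm (flat g X) x ![orientedBasis o x (i + 1), orientedBasis o x (i + 2)] •
      orientedBasis o x i

/-- `ρ` is a first integral of the vector field `X`: `X(ρ) = dρ(X) = 0` on `M`. -/
def IsFirstIntegral (ρ : M → ℝ) (X : ∀ x : M, T x) : Prop :=
  ∀ x : M, (mfderiv (𝓡∂ 3) 𝓘(ℝ, ℝ) ρ x : T x →L[ℝ] ℝ) (X x) = 0

/-- `c` is a regular value of `ρ`: the differential of `ρ` vanishes nowhere on `ρ⁻¹(c)`. -/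
def IsRegularValue (ρ : M → ℝ) (c : ℝ) : Prop :=
  ∀ x : M, ρ x = c → (mfderiv (𝓡∂ 3) 𝓘(ℝ, ℝ) ρ x : T x →L[ℝ] ℝ) ≠ 0

/-- The standard 2-sphere. -/
abbrev S2 : Type := Metric.sphere (0 : EuclideanSpace ℝ (Fin 3)) 1

/-- `S ⊆ M` is an embedded submanifold of `M` diffeomorphic to the 2-sphere: the image of a
smooth embedding (an immersion that is a topological embedding) of the 2-sphere. -/
def IsEmbeddedSphere (S : Set M) : Prop :=
  ∃ ι : S2 → M, ContMDiff (𝓡 2) (𝓡∂ 3) ∞ ι ∧ Topology.IsEmbedding ι ∧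
    (∀ z : S2, Function.Injective (mfderiv (𝓡 2) (𝓡∂ 3) ι z)) ∧ Set.range ι = S

end Manifold

end Riem3

end

open scoped Manifold ContDiff Topology

namespace Riem3

/-! ### Sard's theorem for functions on the plane -/

section Sard
open MeasureTheory Set

/-! Near `S` the level sets of `ρ` are spheres, and `B` is tangent to them. Two one-forms live on
each such sphere: the restriction `α` of `B♭`, and the restriction `β` of `vol(B, ∂ₜ, ·)`, where
`∂ₜ` is the transverse coordinate field of a parametrization in which `ρ = t + c`. The form `α` is
closed because `∇ × B` is tangent to the sphere, so that `d(B♭)` vanishes on its tangent planes. The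
form `β` is closed because `ι_B vol` is closed and vanishes on the tangent planes of all nearby
level sets. Where `B ≠ 0`, the pair `(α, β)` is a coframe: `β(v) = 0` makes `v` parallel to `B`, and
then `α(v) = g(B, v) = 0` gives `v = 0`.

A sphere has no first cohomology, so `α = df` and `β = dh`. The map `(f, h)` from the sphere to the
plane is a local diffeomorphism wherever `df ≠ 0`. On the vertical line over any value of `f`, the
topmost point of the compact image cannot come from such a point, since the image would then contain
points directly above it. Hence every value of `f` is critical, the range of `f` is null by Sard's
theorem, and `f` is constant. So `α = 0`, and `B = 0` because `α(B) = g(B, B)`. This is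
`eq_zero_of_closed_coframe`, carried out on the plane in two stereographic charts, and transferred
to `M` by `IsSlicing.eq_zero_of_glue`.

The level spheres come from `exists_isCollar`: the inclusion `S ≅ 𝕊² ⊆ ℝ³` is extended to `M` and
rescaled to have norm `1 + (ρ - c)`. This yields a map `G` injective near `S`, and
`IsCollar.exists_eq_smul` shows by connectedness that its image contains the whole sphere of every
nearby radius that it meets, other than radius `1`. The sphere `S` itself, which may lie in `∂M`, is
avoided throughout. There `B = 0` follows by continuity, since `ρ` is not locally constant at a
point where `dρ ≠ 0`. -/

/-- Integrating a bound on the derivative that vanishes to order `n` at `x`. -/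
theorem norm_sub_le_of_norm_fderiv_le_pow {E F : Type*} [NormedAddCommGroup E] [NormedSpace ℝ E]
    [NormedAddCommGroup F] [NormedSpace ℝ F] {g : E → F} {s : Set E} (hs : Convex ℝ s)
    (hg : Differentiable ℝ g) {K : ℝ} {n : ℕ} {x : E} (hx : x ∈ s) (hK : 0 ≤ K)
    (h : ∀ y ∈ s, ‖fderiv ℝ g y‖ ≤ K * ‖y - x‖ ^ n) {y : E} (hy : y ∈ s) :
    ‖g y - g x‖ ≤ K * ‖y - x‖ ^ (n + 1) := by
  have hsub : segment ℝ x y ⊆ s := hs.segment_subset hx hy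
  have := (convex_segment x y).norm_image_sub_le_of_norm_fderiv_le (𝕜 := ℝ) (f := g)
    (C := K * ‖y - x‖ ^ n) (fun z _ => hg z) (fun z hz => ?_)
    (left_mem_segment ℝ x y) (right_mem_segment ℝ x y)
  · rwa [mul_assoc, ← pow_succ] at this
  · refine (h z (hsub hz)).trans ?_
    have : ‖z - x‖ ≤ ‖y - x‖ := by
      obtain ⟨t, ht, rfl⟩ := (segment_eq_image' ℝ x y) ▸ hz
      simp only [add_sub_cancel_left, norm_smul, Real.norm_eq_abs]
      rw [abs_of_nonneg ht.1]
      exact mul_le_of_le_one_left (norm_nonneg _) ht.2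
    gcongr

/-- A function which is Hölder with exponent `r` along a set of vanishing `r`-dimensional
measure has null image. -/
theorem volume_image_eq_zero_of_holder {E : Type*} [NormedAddCommGroup E] [MeasurableSpace E]
    [BorelSpace E] {f : E → ℝ} {s : Set E} {K : ℝ} {r : ℕ}
    (hr : 0 < r) (hK : 0 ≤ K) (hμ : Measure.hausdorffMeasure r s = 0)
    (h : ∀ x ∈ s, ∀ y ∈ s, ‖f y - f x‖ ≤ K * ‖y - x‖ ^ r) : volume (f '' s) = 0 := by
  have hol : HolderOnWith K.toNNReal r f s := by
    intro x hx y hy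
    rw [edist_dist, edist_dist, dist_comm, dist_comm x, dist_eq_norm, dist_eq_norm]
    simp only [NNReal.coe_natCast, ENNReal.rpow_natCast]
    rw [← ENNReal.ofReal_pow (norm_nonneg _), ← ENNReal.ofReal_coe_nnreal,
      ← ENNReal.ofReal_mul (by positivity), Real.coe_toNNReal _ hK]
    exact ENNReal.ofReal_le_ofReal (h x hx y hy)
  have := hol.hausdorffMeasure_image_le (by exact_mod_cast hr) (d := 1) zero_le_one
  rw [hausdorffMeasure_real] at this
  simpa [hμ] using this

theorem exists_bound_on_closedBall {F : Type*} [NormedAddCommGroup F] {g : ℝ × ℝ → F}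
    (hg : Continuous g) (n : ℕ) :
    ∃ K, 0 ≤ K ∧ ∀ y ∈ Metric.closedBall (0 : ℝ × ℝ) n, ‖g y‖ ≤ K := by
  obtain ⟨K, hK⟩ := (isCompact_closedBall (0 : ℝ × ℝ) n).exists_bound_of_continuousOn
    hg.continuousOn
  exact ⟨|K|, abs_nonneg _, fun y hy => (hK y hy).trans (le_abs_self K)⟩

theorem volume_image_eq_zero_of_forall_closedBall {f : ℝ × ℝ → ℝ} {s : Set (ℝ × ℝ)}
    (h : ∀ n : ℕ, volume (f '' (s ∩ Metric.closedBall 0 n)) = 0) : volume (f '' s) = 0 := by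
  have : f '' s ⊆ ⋃ n : ℕ, f '' (s ∩ Metric.closedBall 0 n) := by
    rintro _ ⟨x, hx, rfl⟩
    obtain ⟨n, hn⟩ := exists_nat_ge ‖x‖
    exact mem_iUnion.2 ⟨n, x, ⟨hx, by simpa using hn⟩, rfl⟩
  exact measure_mono_null this (measure_iUnion_null h)

variable {f : ℝ × ℝ → ℝ}

/-- Where both derivatives vanish, `f` varies at most cubically, while the plane has Hausdorff
dimension `2 < 3`. -/
theorem volume_image_flat_eq_zero (hf : ContDiff ℝ ∞ f) :
    volume (f '' {x | fderiv ℝ f x = 0 ∧ fderiv ℝ (fderiv ℝ f) x = 0}) = 0 := by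
  have h1 : ContDiff ℝ ∞ (fderiv ℝ f) := hf.fderiv_right (by simp)
  have h2 : ContDiff ℝ ∞ (fderiv ℝ (fderiv ℝ f)) := h1.fderiv_right (by simp)
  refine volume_image_eq_zero_of_forall_closedBall fun n => ?_
  obtain ⟨K, hK0, hK⟩ := exists_bound_on_closedBall
    (h2.fderiv_right (m := ∞) (by simp)).continuous n
  refine volume_image_eq_zero_of_holder (r := 3) (by norm_num) hK0 ?_ ?_
  · have hdim : dimH ((univ : Set (ℝ × ℝ))) < ((3 : NNReal) : ENNReal) := by
      rw [Real.dimH_univ_eq_finrank]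
      simp
      norm_num
    exact measure_mono_null (subset_univ _) (by exact_mod_cast hausdorffMeasure_of_dimH_lt hdim)
  · rintro x ⟨⟨hx1, hx2⟩, hxn⟩ y ⟨-, hyn⟩
    have hc := convex_closedBall (0 : ℝ × ℝ) n
    refine norm_sub_le_of_norm_fderiv_le_pow hc (hf.differentiable (by simp)) hxn hK0
      (fun z hz => ?_) hyn
    rw [← sub_zero (fderiv ℝ f z), ← hx1]
    refine norm_sub_le_of_norm_fderiv_le_pow hc (h1.differentiable (by simp)) hxn hK0
      (fun w hw => ?_) hz
    rw [← sub_zero (fderiv ℝ (fderiv ℝ f) w), ← hx2]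
    refine norm_sub_le_of_norm_fderiv_le_pow hc (h2.differentiable (by simp)) hxn hK0
      (fun w hw => ?_) hw
    simpa using hK w hw

/-- The nondegenerate zeros of a function of one variable are isolated. -/
theorem countable_zeros_of_deriv_ne_zero {u u' : ℝ → ℝ}
    (hu : ∀ t, HasDerivAt u (u' t) t) : {t | u t = 0 ∧ u' t ≠ 0}.Countable := by
  -- Any set of reals has only countably many points that are isolated in it from the right.
  have hc := countable_setOfPred_isolated_right_within (s := {t | u t = 0 ∧ u' t ≠ 0})
  refine hc.mono fun t ht => mem_sep ht ?_
  have h1 : ∀ᶠ z in 𝓝[≠] t, u z ≠ 0 := (hu t).eventually_ne ht.2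
  rw [← Filter.eventually_false_iff_eq_bot]
  filter_upwards [h1.filter_mono (nhdsWithin_mono _ fun z hz => ne_of_gt hz.2),
    self_mem_nhdsWithin] with z hz hz'
  exact hz hz'.1.1

/-- Fubini: where a given partial derivative is nonzero, each line in that direction meets the zero
set in a countable set. -/
theorem volume_zeros_eq_zero {h : ℝ × ℝ → ℝ} (hh : ContDiff ℝ ∞ h) :
    volume {x | h x = 0 ∧ fderiv ℝ h x ≠ 0} = 0 := by
  have hd : Differentiable ℝ h := hh.differentiable (by simp)
  have hd' : Continuous (fderiv ℝ h) := hh.continuous_fderiv (by simp)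
  have hmeas : ∀ v : ℝ × ℝ, MeasurableSet {x | h x = 0 ∧ fderiv ℝ h x v ≠ 0} := fun v =>
    (isClosed_eq hh.continuous continuous_const).measurableSet.inter
      (isOpen_ne_fun (hd'.clm_apply continuous_const) continuous_const).measurableSet
  have hfst : volume {x | h x = 0 ∧ fderiv ℝ h x (1, 0) ≠ 0} = 0 := by
    rw [Measure.volume_eq_prod, Measure.prod_apply_symm (hmeas _)]
    refine (lintegral_congr fun t => ?_).trans lintegral_zero
    refine (countable_zeros_of_deriv_ne_zero (u := fun a => h (a, t))
      (u' := fun a => fderiv ℝ h (a, t) (1, 0)) fun a => ?_).measure_zero _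
    exact (hd (a, t)).hasFDerivAt.comp_hasDerivAt a
      ((hasDerivAt_id a).prodMk (hasDerivAt_const a t))
  have hsnd : volume {x | h x = 0 ∧ fderiv ℝ h x (0, 1) ≠ 0} = 0 := by
    rw [Measure.volume_eq_prod, Measure.prod_apply (hmeas _)]
    refine (lintegral_congr fun t => ?_).trans lintegral_zero
    refine (countable_zeros_of_deriv_ne_zero (u := fun a => h (t, a))
      (u' := fun a => fderiv ℝ h (t, a) (0, 1)) fun a => ?_).measure_zero _
    exact (hd (t, a)).hasFDerivAt.comp_hasDerivAt a
      ((hasDerivAt_const a t).prodMk (hasDerivAt_id a))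
  refine measure_mono_null ?_ (measure_union_null hfst hsnd)
  rintro x ⟨hx, hx'⟩
  by_contra hcon
  simp only [mem_union, mem_ofPred_eq, hx, true_and, not_or, not_not] at hcon
  refine hx' (ContinuousLinearMap.ext fun v => ?_)
  have : v = v.1 • ((1 : ℝ), (0 : ℝ)) + v.2 • ((0 : ℝ), (1 : ℝ)) := by ext <;> simp
  rw [this, map_add, map_smul, map_smul, hcon.1, hcon.2]
  simp

/-- At such a point some partial derivative of `f` vanishes with nonzero gradient, so the set itself
is null in the plane; `f` varies at most quadratically along it, which suffices because planar
measure is two-dimensional Hausdorff measure. -/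
theorem volume_image_nondegenerate_eq_zero (hf : ContDiff ℝ ∞ f) :
    volume (f '' {x | fderiv ℝ f x = 0 ∧ fderiv ℝ (fderiv ℝ f) x ≠ 0}) = 0 := by
  have h1 : ContDiff ℝ ∞ (fderiv ℝ f) := hf.fderiv_right (by simp)
  have h1d := h1.differentiable (by simp)
  have hnull : volume {x | fderiv ℝ f x = 0 ∧ fderiv ℝ (fderiv ℝ f) x ≠ 0} = 0 := by
    have hz : ∀ v : ℝ × ℝ, volume {x | fderiv ℝ f x v = 0 ∧
        fderiv ℝ (fun y => fderiv ℝ f y v) x ≠ 0} = 0 := fun v =>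
      volume_zeros_eq_zero (h1.clm_apply contDiff_const)
    refine measure_mono_null ?_ (measure_union_null (hz (1, 0)) (hz (0, 1)))
    rintro x ⟨hx, hx'⟩
    by_contra hcon
    simp only [mem_union, mem_ofPred_eq, hx, zero_apply, true_and, not_or,
      not_not] at hcon
    refine hx' (ContinuousLinearMap.ext fun w => ContinuousLinearMap.ext fun v => ?_)
    have happ : ∀ v, fderiv ℝ (fun y => fderiv ℝ f y v) x w = fderiv ℝ (fderiv ℝ f) x w v := by
      intro v
      rw [fderiv_clm_apply (h1d x) (differentiableAt_const v)]
      simp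
    have : v = v.1 • ((1 : ℝ), (0 : ℝ)) + v.2 • ((0 : ℝ), (1 : ℝ)) := by ext <;> simp
    rw [this, map_add, map_smul, map_smul, ← happ, ← happ, hcon.1, hcon.2]
    simp
  refine volume_image_eq_zero_of_forall_closedBall fun n => ?_
  obtain ⟨K, hK0, hK⟩ := exists_bound_on_closedBall (h1.continuous_fderiv (by simp)) n
  refine volume_image_eq_zero_of_holder (r := 2) (by norm_num) hK0 ?_ ?_
  · rw [Nat.cast_ofNat, hausdorffMeasure_prod_real]
    exact measure_mono_null inter_subset_left hnull
  · rintro x ⟨⟨hx1, -⟩, hxn⟩ y ⟨-, hyn⟩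
    have hc := convex_closedBall (0 : ℝ × ℝ) n
    refine norm_sub_le_of_norm_fderiv_le_pow hc (hf.differentiable (by simp)) hxn hK0
      (fun z hz => ?_) hyn
    rw [← sub_zero (fderiv ℝ f z), ← hx1]
    refine norm_sub_le_of_norm_fderiv_le_pow hc h1d hxn hK0 (fun w hw => ?_) hz
    simpa using hK w hw

/-- Sard's theorem for real functions of two variables. -/
theorem volume_image_critical_eq_zero (hf : ContDiff ℝ ∞ f) :
    volume (f '' {x | fderiv ℝ f x = 0}) = 0 := by
  have : {x | fderiv ℝ f x = 0} = {x | fderiv ℝ f x = 0 ∧ fderiv ℝ (fderiv ℝ f) x = 0} ∪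
      {x | fderiv ℝ f x = 0 ∧ fderiv ℝ (fderiv ℝ f) x ≠ 0} := by
    ext x; simp [← and_or_left, em]
  rw [this, image_union]
  exact measure_union_null (volume_image_flat_eq_zero hf) (volume_image_nondegenerate_eq_zero hf)

end Sard

/-! ### Maps from the compactified plane to the plane -/

section Plane
open MeasureTheory Set Filter

/-- A smooth map `(f, h)` from the plane to the plane that extends continuously to the sphere, and
whose differential is invertible wherever that of `f` does not vanish, has constant `f`: over
every value of `f` other than the one at infinity, the topmost point of the image is critical. -/
theorem fderiv_eq_zero_of_tendsto_cocompact {f h : ℝ × ℝ → ℝ} (hf : ContDiff ℝ ∞ f)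
    (hh : ContDiff ℝ ∞ h) {a b : ℝ} (ha : Tendsto f (cocompact _) (𝓝 a))
    (hb : Tendsto h (cocompact _) (𝓝 b))
    (hreg : ∀ x, fderiv ℝ f x = 0 ∨
      Function.Injective ((fderiv ℝ f x).prod (fderiv ℝ h x))) (x : ℝ × ℝ) :
    fderiv ℝ f x = 0 := by
  have hF : ContDiff ℝ ∞ fun x => (f x, h x) := hf.prodMk hh
  -- Adjoining the value at infinity makes the image compact, so topmost points exist.
  have hK : IsCompact (insert (a, b) (range fun x => (f x, h x))) :=
    (ha.prodMk_nhds hb).isCompact_insert_range_of_cocompact hF.continuous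
  set K := insert (a, b) (range fun x => (f x, h x))
  have hsub : range f ⊆ insert a (f '' {x | fderiv ℝ f x = 0}) := by
    rintro _ ⟨y, rfl⟩
    have hKy : IsCompact (K ∩ Prod.fst ⁻¹' {f y}) :=
      hK.inter_right (isClosed_singleton.preimage continuous_fst)
    obtain ⟨k, ⟨hkK, hky⟩, hkmax⟩ := hKy.exists_isMaxOn
      ⟨(f y, h y), mem_insert_of_mem _ ⟨y, rfl⟩, rfl⟩ continuous_snd.continuousOn
    rcases hkK with rfl | ⟨z, rfl⟩
    · exact Or.inl hky.symm
    · rcases hreg z with hz | hz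
      · exact Or.inr ⟨z, hz, hky⟩
      · exfalso
        have hstrict : HasStrictFDerivAt (fun x => (f x, h x))
            ((fderiv ℝ f z).prod (fderiv ℝ h z)) z :=
          (hf.contDiffAt.hasStrictFDerivAt (by simp)).prodMk
            (hh.contDiffAt.hasStrictFDerivAt (by simp))
        have hsurj : ((fderiv ℝ f z).prod (fderiv ℝ h z)).range = ⊤ :=
          LinearMap.range_eq_top.2 ((LinearMap.injective_iff_surjective).1 hz)
        have hnhds := hstrict.map_nhds_eq_of_surj hsurj
        -- A submersion is open, so the image surrounds this point and contains points directly
        -- above it, against maximality.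
        have hmem : K ∈ 𝓝 (f z, h z) := by
          rw [← hnhds]
          exact mem_map.2 (univ_mem' fun w => mem_insert_of_mem _ ⟨w, rfl⟩)
        have hline : Tendsto (fun e : ℝ => (f z, e)) (𝓝[>] (h z)) (𝓝 (f z, h z)) :=
          ((continuous_const.prodMk continuous_id).tendsto (h z)).mono_left nhdsWithin_le_nhds
        obtain ⟨e, he, hlt⟩ := ((hline.eventually hmem).and self_mem_nhdsWithin).exists
        exact absurd (hkmax ⟨he, hky⟩) (not_le.2 hlt)
  have hnull : volume (range f) = 0 :=
    measure_mono_null hsub ((measure_union_null (measure_singleton a)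
      (volume_image_critical_eq_zero hf) :))
  have hconst : ∀ y z, f y ≤ f z := by
    intro y z
    by_contra! hlt
    have hIcc : Icc (f z) (f y) ⊆ range f := fun t ht =>
      mem_range_of_exists_le_of_exists_ge hf.continuous ⟨z, ht.1⟩ ⟨y, ht.2⟩
    have := measure_mono_null hIcc hnull
    rw [Real.volume_Icc, ENNReal.ofReal_eq_zero] at this
    linarith
  have : f = fun _ => f x := funext fun y => le_antisymm (hconst _ _) (hconst _ _)
  rw [this]
  simp

end Plane
-- Closed one-forms on the sphere in two charts
section Gluing
open Set Filter

/-- The inversion `x ↦ x / |x|²` of the plane, the transition map between the two stereographic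
charts of the sphere. -/
noncomputable def planeInv (x : ℝ × ℝ) : ℝ × ℝ := (x.1 ^ 2 + x.2 ^ 2)⁻¹ • x

theorem sq_add_sq_pos {x : ℝ × ℝ} (hx : x ≠ 0) : 0 < x.1 ^ 2 + x.2 ^ 2 := by
  by_contra! h
  exact hx (Prod.ext (by simpa using by nlinarith [sq_nonneg x.1, sq_nonneg x.2])
    (by simpa using by nlinarith [sq_nonneg x.1, sq_nonneg x.2]))

theorem contDiffAt_planeInv {x : ℝ × ℝ} (hx : x ≠ 0) : ContDiffAt ℝ ∞ planeInv x := by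
  have h : ContDiff ℝ ∞ fun x : ℝ × ℝ => x.1 ^ 2 + x.2 ^ 2 :=
    (contDiff_fst.pow 2).add (contDiff_snd.pow 2)
  exact (h.contDiffAt.inv (sq_add_sq_pos hx).ne').smul contDiffAt_id

theorem tendsto_planeInv_cocompact : Tendsto planeInv (cocompact (ℝ × ℝ)) (𝓝 0) := by
  have hinv : Tendsto (fun x : ℝ × ℝ => ‖x‖⁻¹) (cocompact _) (𝓝 0) :=
    tendsto_inv_atTop_zero.comp (tendsto_norm_cocompact_atTop (E := ℝ × ℝ))
  refine squeeze_zero_norm (fun x => ?_) hinv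
  rcases eq_or_ne x 0 with rfl | hx
  · simp [planeInv]
  have hn : 0 < ‖x‖ := norm_pos_iff.2 hx
  -- The norm on the product is the maximum norm, which the Euclidean one dominates.
  have hle : ‖x‖ ^ 2 ≤ x.1 ^ 2 + x.2 ^ 2 := by
    rcases max_choice ‖x.1‖ ‖x.2‖ with h | h
    · rw [Prod.norm_def, h, Real.norm_eq_abs, sq_abs]; nlinarith [sq_nonneg x.2]
    · rw [Prod.norm_def, h, Real.norm_eq_abs, sq_abs]; nlinarith [sq_nonneg x.1]
  rw [planeInv, norm_smul, norm_inv, Real.norm_of_nonneg (sq_add_sq_pos hx).le]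
  calc (x.1 ^ 2 + x.2 ^ 2)⁻¹ * ‖x‖ ≤ (‖x‖ ^ 2)⁻¹ * ‖x‖ := by gcongr
    _ = ‖x‖⁻¹ := by field_simp

/-- A closed one-form on the sphere, given in the two stereographic charts, has a primitive on the
first chart that extends continuously to the point at infinity. -/
theorem exists_primitive_tendsto_cocompact {α₁ α₂ : ℝ × ℝ → ℝ × ℝ →L[ℝ] ℝ}
    (h₁ : Differentiable ℝ α₁) (h₂ : Differentiable ℝ α₂)
    (hs₁ : ∀ x v w, fderiv ℝ α₁ x v w = fderiv ℝ α₁ x w v)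
    (hs₂ : ∀ x v w, fderiv ℝ α₂ x v w = fderiv ℝ α₂ x w v)
    (hglue : ∀ x ≠ 0, α₁ x = (α₂ (planeInv x)).comp (fderiv ℝ planeInv x)) :
    ∃ f : ℝ × ℝ → ℝ, (∀ x, HasFDerivAt f (α₁ x) x) ∧
      ∃ a, Tendsto f (cocompact _) (𝓝 a) := by
  obtain ⟨f₁, hf₁⟩ := convex_univ.exists_forall_hasFDerivAt_of_fderiv_symmetric isOpen_univ
    h₁.differentiableOn fun x _ => hs₁ x
  obtain ⟨f₂, hf₂⟩ := convex_univ.exists_forall_hasFDerivAt_of_fderiv_symmetric isOpen_univ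
    h₂.differentiableOn fun x _ => hs₂ x
  have hrank : 1 < Module.rank ℝ (ℝ × ℝ) := by
    rw [← Module.finrank_eq_rank, Module.finrank_prod]; simp
  -- The overlap of the two charts is connected, so the two primitives differ there by a single
  -- constant; this is the vanishing of the first cohomology of the sphere.
  have hconn := (isConnected_compl_singleton_of_one_lt_rank hrank (0 : ℝ × ℝ)).isPreconnected
  have hder : ∀ x : ℝ × ℝ, x ≠ 0 → HasFDerivAt (fun y => f₁ y - f₂ (planeInv y)) (0 : ℝ × ℝ →L[ℝ] ℝ) x := by
    intro x hx
    have := (hf₁ x trivial).sub ((hf₂ (planeInv x) trivial).comp x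
      ((contDiffAt_planeInv hx).differentiableAt (by simp)).hasFDerivAt)
    rwa [← hglue x hx, sub_self] at this
  obtain ⟨c, hc⟩ := (isOpen_compl_singleton (x := (0 : ℝ × ℝ))).exists_is_const_of_fderiv_eq_zero hconn
    (fun x hx => (hder x hx).differentiableAt.differentiableWithinAt)
    (fun x hx => (hder x hx).fderiv)
  refine ⟨f₁, fun x => hf₁ x trivial, c + f₂ 0, ?_⟩
  have hlim : Tendsto (fun y => c + f₂ (planeInv y)) (cocompact _) (𝓝 (c + f₂ 0)) :=
    ((hf₂ 0 trivial).continuousAt.tendsto.comp tendsto_planeInv_cocompact).const_add c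
  refine hlim.congr' ?_
  filter_upwards [(isCompact_singleton (x := (0 : ℝ × ℝ))).compl_mem_cocompact] with y hy
  have := hc y hy
  linarith

/-- Two closed one-forms on the sphere which at every point either vanish or form a coframe
vanish. -/
theorem eq_zero_of_closed_coframe {α₁ α₂ β₁ β₂ : ℝ × ℝ → ℝ × ℝ →L[ℝ] ℝ}
    (hα₁ : ContDiff ℝ ∞ α₁) (hα₂ : ContDiff ℝ ∞ α₂)
    (hβ₁ : ContDiff ℝ ∞ β₁) (hβ₂ : ContDiff ℝ ∞ β₂)
    (hsα₁ : ∀ x v w, fderiv ℝ α₁ x v w = fderiv ℝ α₁ x w v)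
    (hsα₂ : ∀ x v w, fderiv ℝ α₂ x v w = fderiv ℝ α₂ x w v)
    (hsβ₁ : ∀ x v w, fderiv ℝ β₁ x v w = fderiv ℝ β₁ x w v)
    (hsβ₂ : ∀ x v w, fderiv ℝ β₂ x v w = fderiv ℝ β₂ x w v)
    (hgα : ∀ x ≠ 0, α₁ x = (α₂ (planeInv x)).comp (fderiv ℝ planeInv x))
    (hgβ : ∀ x ≠ 0, β₁ x = (β₂ (planeInv x)).comp (fderiv ℝ planeInv x))
    (hreg : ∀ x, α₁ x = 0 ∨ Function.Injective ((α₁ x).prod (β₁ x))) (x : ℝ × ℝ) :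
    α₁ x = 0 := by
  obtain ⟨f, hf, a, ha⟩ := exists_primitive_tendsto_cocompact (hα₁.differentiable (by simp))
    (hα₂.differentiable (by simp)) hsα₁ hsα₂ hgα
  obtain ⟨h, hh, b, hb⟩ := exists_primitive_tendsto_cocompact (hβ₁.differentiable (by simp))
    (hβ₂.differentiable (by simp)) hsβ₁ hsβ₂ hgβ
  have hfd : fderiv ℝ f = α₁ := funext fun x => (hf x).fderiv
  have hhd : fderiv ℝ h = β₁ := funext fun x => (hh x).fderiv
  have hfs : ContDiff ℝ ∞ f :=
    contDiff_infty_iff_fderiv.2 ⟨fun x => (hf x).differentiableAt, hfd ▸ hα₁⟩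
  have hhs : ContDiff ℝ ∞ h :=
    contDiff_infty_iff_fderiv.2 ⟨fun x => (hh x).differentiableAt, hhd ▸ hβ₁⟩
  have := fderiv_eq_zero_of_tendsto_cocompact hfs hhs ha hb (by rwa [hfd, hhd]) x
  rwa [hfd] at this

end Gluing
-- Linear algebra of a three-dimensional tangent space
section Pointwise

variable {V : Type*} [AddCommGroup V] [Module ℝ V] [TopologicalSpace V]

theorem interiorProduct_apply {k : ℕ} (X : V) (α : V [⋀^Fin (k + 1)]→L[ℝ] ℝ) (v : Fin k → V) :
    interiorProduct X α v = α (Matrix.vecCons X v) := rfl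

variable {G : V →L[ℝ] V →L[ℝ] ℝ}

/-- The matrix of scalar products of two families, in terms of their coordinates. -/
theorem gram_eq_transpose_mul (b : Module.Basis (Fin 3) ℝ V) (Y Z : Fin 3 → V) :
    (Matrix.of fun i j => G (Y i) (Z j)) =
      (b.toMatrix Y).transpose * (Matrix.of fun i j => G (b i) (b j)) * b.toMatrix Z := by
  ext i j
  conv_lhs => rw [Matrix.of_apply, ← b.sum_repr (Y i), ← b.sum_repr (Z j)]
  simp only [map_sum, map_smul, sum_apply, smul_apply,
    smul_eq_mul, Matrix.mul_apply, Matrix.transpose_apply, Matrix.of_apply,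
    Module.Basis.toMatrix_apply, Finset.mul_sum, Finset.sum_mul]
  refine Finset.sum_congr rfl fun k _ => Finset.sum_congr rfl fun l _ => ?_
  ring

theorem det_gram_pos (hpos : ∀ v, v ≠ 0 → 0 < G v v) (hsymm : ∀ v w, G v w = G w v)
    (b : Module.Basis (Fin 3) ℝ V) : 0 < (Matrix.of fun i j => G (b i) (b j)).det := by
  refine Matrix.PosDef.det_pos (Matrix.PosDef.of_dotProduct_mulVec_pos ?_ fun {x} hx => ?_)
  · ext i j
    simp [hsymm (b j)]
  · have hne : ∑ i, x i • b i ≠ 0 := fun h =>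
      hx (funext fun i => Fintype.linearIndependent_iff.1 b.linearIndependent x h i)
    have heq : star x ⬝ᵥ (Matrix.of fun i j => G (b i) (b j)).mulVec x =
        G (∑ i, x i • b i) (∑ i, x i • b i) := by
      simp only [map_sum, map_smul, sum_apply, smul_apply, smul_eq_mul, dotProduct,
        Matrix.mulVec, Matrix.of_apply, Finset.mul_sum, star_trivial]
      refine Finset.sum_congr rfl fun k _ => Finset.sum_congr rfl fun l _ => ?_
      rw [hsymm (b k)]
      ring
    rw [heq]
    exact hpos _ hne

/-- The volume form in terms of a positively oriented frame `Y` and scalar products. -/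
theorem sqrt_gram_mul_det (hpos : ∀ v, v ≠ 0 → 0 < G v v) (hsymm : ∀ v w, G v w = G w v)
    (b : Module.Basis (Fin 3) ℝ V) {Y : Fin 3 → V} (hY : 0 < b.det Y) (Z : Fin 3 → V) :
    √(Matrix.of fun i j => G (b i) (b j)).det * b.det Z =
      (Matrix.of fun i j => G (Y i) (Z j)).det / √(Matrix.of fun i j => G (Y i) (Y j)).det := by
  have hD := det_gram_pos hpos hsymm b
  rw [gram_eq_transpose_mul b Y Z, gram_eq_transpose_mul b Y Y]
  simp only [Matrix.det_mul, Matrix.det_transpose]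
  rw [Module.Basis.det_apply] at hY
  rw [Module.Basis.det_apply]
  set D := (Matrix.of fun i j => G (b i) (b j)).det
  set p := (b.toMatrix Y).det
  have hs : √(p * D * p) = p * √D := by
    rw [show p * D * p = p ^ 2 * D by ring, Real.sqrt_mul (by positivity), Real.sqrt_sq hY.le]
  have h2 := Real.mul_self_sqrt hD.le
  have h3 := Real.sqrt_pos.2 hD
  rw [hs, eq_div_iff (by positivity)]
  linear_combination p * (b.toMatrix Z).det * h2

/-- A `2`-form as a bilinear map. -/
theorem exists_bilinear_of_twoForm (D : V [⋀^Fin 2]→L[ℝ] ℝ) :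
    ∃ L : V →ₗ[ℝ] V →ₗ[ℝ] ℝ, (∀ v w, D ![v, w] = L v w) ∧ ∀ v, L v v = 0 := by
  have h0 : ∀ v w x : V, Function.update ![v, w] 0 x = ![x, w] := fun v w x => by
    funext i; fin_cases i <;> rfl
  have h1 : ∀ v w x : V, Function.update ![v, w] 1 x = ![v, x] := fun v w x => by
    funext i; fin_cases i <;> rfl
  refine ⟨LinearMap.mk₂ ℝ (fun v w => D ![v, w]) (fun v v' w => ?_) (fun c v w => ?_)
    (fun v w w' => ?_) (fun c v w => ?_), fun v w => rfl, fun v => ?_⟩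
  · simpa only [h0] using D.map_update_add ![v, w] 0 v v'
  · simpa only [h0] using D.map_update_smul ![v, w] 0 c v
  · simpa only [h1] using D.map_update_add ![v, w] 1 w w'
  · simpa only [h1] using D.map_update_smul ![v, w] 1 c w
  · exact D.map_eq_zero_of_eq ![v, v] (i := 0) (j := 1) rfl (by decide)

/-- An alternating `2`-form whose exterior product with `r` vanishes on a basis vanishes on the
kernel of `r`. -/
theorem alternating_eq_zero_of_wedge_eq_zero (b : Module.Basis (Fin 3) ℝ V)
    (D : V [⋀^Fin 2]→L[ℝ] ℝ) (r : V →ₗ[ℝ] ℝ) (hr : r ≠ 0)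
    (h : ∑ i : Fin 3, D ![b (i + 1), b (i + 2)] * r (b i) = 0)
    {v w : V} (hv : r v = 0) (hw : r w = 0) : D ![v, w] = 0 := by
  obtain ⟨L, hL, hL0⟩ := exists_bilinear_of_twoForm D
  have hanti : ∀ v w, L w v = - L v w := fun v w => by
    have := hL0 (v + w)
    simp only [map_add, LinearMap.add_apply, hL0] at this
    linarith
  have hsum : ∀ v, v = b.repr v 0 • b 0 + b.repr v 1 • b 1 + b.repr v 2 • b 2 := fun v => by
    conv_lhs => rw [← b.sum_repr v, Fin.sum_univ_three]
  simp only [Fin.sum_univ_three, hL] at h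
  simp only [Fin.isValue, zero_add, Fin.reduceAdd] at h
  rw [hL]
  rw [hsum v] at hv ⊢
  rw [hsum w] at hw ⊢
  set v0 := b.repr v 0; set v1 := b.repr v 1; set v2 := b.repr v 2
  set w0 := b.repr w 0; set w1 := b.repr w 1; set w2 := b.repr w 2
  simp only [map_add, map_smul, LinearMap.add_apply, LinearMap.smul_apply, smul_eq_mul, hL0,
    hanti (b 0) (b 1), hanti (b 1) (b 2), hanti (b 2) (b 0)] at hv hw h ⊢
  have hk : ∃ k, r (b k) ≠ 0 := by
    by_contra! hk
    exact hr (b.ext fun k => by simp [hk k])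
  obtain ⟨k, hk⟩ := hk
  refine (mul_eq_zero.1 ?_).resolve_left hk
  -- As `v` and `w` lie in the kernel of `r`, the cross product of their coordinates is proportional
  -- to the coefficients of `r`. Each combination uses this to compare `D(v, w) r(b k)` with a
  -- multiple of the wedge condition `h`.
  fin_cases k <;> simp only [Fin.zero_eta, Fin.mk_one, Fin.reduceFinMk]
  · linear_combination (v1 * w2 - v2 * w1) * h + (L (b 0) (b 1) * w1 - L (b 2) (b 0) * w2) * hv
      - (L (b 0) (b 1) * v1 - L (b 2) (b 0) * v2) * hw
  · linear_combination (v2 * w0 - v0 * w2) * h + (L (b 1) (b 2) * w2 - L (b 0) (b 1) * w0) * hv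
      - (L (b 1) (b 2) * v2 - L (b 0) (b 1) * v0) * hw
  · linear_combination (v0 * w1 - v1 * w0) * h + (L (b 2) (b 0) * w0 - L (b 1) (b 2) * w1) * hv
      - (L (b 2) (b 0) * v0 - L (b 1) (b 2) * v1) * hw

end Pointwise
-- Smoothness of `B♭` and `ι_B vol` in charts
section SmoothForms
open Set Filter

variable {M : Type*} [TopologicalSpace M] [ChartedSpace (EuclideanHalfSpace 3) M]

/-- A family of alternating forms on a finite-dimensional space is smooth if its values are. -/
theorem contDiffWithinAt_of_forall_apply {k : ℕ} {E F : Type*} [NormedAddCommGroup E]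
    [NormedSpace ℝ E] [NormedAddCommGroup F] [NormedSpace ℝ F] [FiniteDimensional ℝ F]
    {f : E → F [⋀^Fin k]→L[ℝ] ℝ} {s : Set E} {x : E}
    (h : ∀ v : Fin k → F, ContDiffWithinAt ℝ ∞ (fun y => f y v) s x) :
    ContDiffWithinAt ℝ ∞ f s x := by
  let b := Module.finBasis ℝ F
  let ev : (F [⋀^Fin k]→L[ℝ] ℝ) →ₗ[ℝ] ((Fin k → Fin (Module.finrank ℝ F)) → ℝ) :=
    { toFun := fun α I => α fun j => b (I j)
      map_add' := fun _ _ => rfl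
      map_smul' := fun _ _ => rfl }
  -- A multilinear form is determined by its values on tuples of basis vectors, so finitely many
  -- smooth coefficients recover it through a linear left inverse.
  have hinj : LinearMap.ker ev = ⊥ := by
    refine LinearMap.ker_eq_bot'.2 fun α hα => ?_
    have h0 : α.toMultilinearMap = 0 :=
      Module.Basis.ext_multilinear (fun _ => b) fun I => congrFun hα I
    ext v
    exact congrArg (fun β => β v) h0
  obtain ⟨L, hL⟩ := ev.exists_leftInverse_of_injective hinj
  have hf : f = fun y => LinearMap.toContinuousLinearMap L (ev (f y)) :=
    funext fun y => (LinearMap.congr_fun hL (f y)).symm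
  rw [hf]
  refine (ContinuousLinearMap.contDiff _).comp_contDiffWithinAt ?_
  exact contDiffWithinAt_pi.2 fun I => h _

variable [IsManifold (𝓡∂ 3) ∞ M]

/-- The vector field near `p` that is constant equal to `v` in the preferred chart at `p`. -/
noncomputable def chartField (p : M) (v : E3) (x : M) : T x :=
  (trivializationAt E3 (TangentSpace (𝓡∂ 3)) p).symmL ℝ x v

/-- Smoothness of a vector field at a point. -/
def SmoothFieldAt (X : ∀ x : M, T x) (p : M) : Prop :=
  ContMDiffAt (𝓡∂ 3) (𝓡∂ 3).tangent ∞ (fun x => (⟨x, X x⟩ : TangentBundle (𝓡∂ 3) M)) p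

theorem smoothFieldAt_chartField (p : M) (v : E3) : SmoothFieldAt (chartField p v) p := by
  have hp : p ∈ (trivializationAt E3 (TangentSpace (𝓡∂ 3)) p).baseSet :=
    FiberBundle.mem_baseSet_trivializationAt E3 (TangentSpace (𝓡∂ 3)) p
  refine ((trivializationAt E3 (TangentSpace (𝓡∂ 3)) p).contMDiffAt_section_iff hp).2 ?_
  refine (contMDiffAt_const (c := v)).congr_of_eventuallyEq ?_
  filter_upwards [(trivializationAt E3 (TangentSpace (𝓡∂ 3)) p).open_baseSet.mem_nhds hp]
    with x hx
  rw [chartField, Bundle.Trivialization.symmL_apply _ hx]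
  exact congrArg Prod.snd ((trivializationAt E3 (TangentSpace (𝓡∂ 3)) p).apply_mk_symm hx v)

theorem contMDiffAt_inner (g : RiemMetric M) {X Y : ∀ x : M, T x} {p : M}
    (hX : SmoothFieldAt X p) (hY : SmoothFieldAt Y p) :
    ContMDiffAt (𝓡∂ 3) 𝓘(ℝ, ℝ) ∞ (fun x => g.inner x (X x) (Y x)) p := by
  have h : ContMDiffAt (𝓡∂ 3) ((𝓡∂ 3).prod 𝓘(ℝ)) ∞ (fun x => Bundle.TotalSpace.mk' ℝ
      (E := Bundle.Trivial M ℝ) x (g.inner x (X x) (Y x))) p :=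
    ContMDiffAt.clm_bundle_apply₂ (F₁ := E3) (F₂ := E3) (b := fun x => x) g.contMDiff.contMDiffAt hX hY
  exact (Bundle.contMDiffAt_section p).1 h |>.congr_of_eventuallyEq (by simp)

/-- On the chart target, the differential of the inverse chart is the inverse of the tangent bundle
trivialization. -/
theorem chartForm_apply {k : ℕ} (α : ∀ x : M, T x [⋀^Fin k]→L[ℝ] ℝ) (p : M) {y : E3}
    (hy : y ∈ (extChartAt (𝓡∂ 3) p).target) (v : Fin k → E3) :
    chartForm α p y v = α ((extChartAt (𝓡∂ 3) p).symm y)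
      (fun j => chartField p (v j) ((extChartAt (𝓡∂ 3) p).symm y)) := by
  have hx : (extChartAt (𝓡∂ 3) p).symm y ∈ (chartAt (EuclideanHalfSpace 3) p).source := by
    rw [← extChartAt_source (𝓡∂ 3)]
    exact (extChartAt (𝓡∂ 3) p).map_target hy
  have h := TangentBundle.symmL_trivializationAt (I := 𝓡∂ 3) (𝕜 := ℝ) hx
  rw [(extChartAt (𝓡∂ 3) p).right_inv hy] at h
  simp only [chartField, h]
  rfl

theorem contDiffWithinAt_chartForm {k : ℕ} {α : ∀ x : M, T x [⋀^Fin k]→L[ℝ] ℝ} {p : M}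
    (h : ∀ X : Fin k → ∀ x : M, T x, (∀ i, SmoothFieldAt (X i) p) →
      ContMDiffAt (𝓡∂ 3) 𝓘(ℝ, ℝ) ∞ (fun x => α x fun i => X i x) p) :
    ContDiffWithinAt ℝ ∞ (chartForm α p) (range (𝓡∂ 3)) (extChartAt (𝓡∂ 3) p p) := by
  refine contDiffWithinAt_of_forall_apply fun v => ?_
  have h1 := (contMDiffAt_iff.1
    (h (fun j => chartField p (v j)) fun j => smoothFieldAt_chartField p (v j))).2
  refine h1.congr_of_eventuallyEq ?_ ?_
  · filter_upwards [extChartAt_target_mem_nhdsWithin (I := 𝓡∂ 3) p] with y hy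
    exact chartForm_apply α p hy v
  · exact chartForm_apply α p (mem_extChartAt_target p) v

theorem contDiffWithinAt_chartForm_flat (g : RiemMetric M) {B : ∀ x : M, T x} {p : M}
    (hB : SmoothFieldAt B p) :
    ContDiffWithinAt ℝ ∞ (chartForm (flat g B) p) (range (𝓡∂ 3)) (extChartAt (𝓡∂ 3) p p) :=
  contDiffWithinAt_chartForm fun _ hX => contMDiffAt_inner g hB (hX 0)

theorem orientedBasis_orientation (o : MfdOrientation M) (x : M) :
    (orientedBasis o x).orientation = o.orient x :=
  Module.Basis.orientation_adjustToOrientation _ _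

omit [IsManifold (𝓡∂ 3) ∞ M] in
theorem contMDiffAt_det {A : M → Matrix (Fin 3) (Fin 3) ℝ} {p : M}
    (h : ∀ i j, ContMDiffAt (𝓡∂ 3) 𝓘(ℝ, ℝ) ∞ (fun x => A x i j) p) :
    ContMDiffAt (𝓡∂ 3) 𝓘(ℝ, ℝ) ∞ (fun x => (A x).det) p := by
  simp only [Matrix.det_fin_three]
  exact ((((((h 0 0).mul (h 1 1)).mul (h 2 2)).sub (((h 0 0).mul (h 1 2)).mul (h 2 1))).sub
    (((h 0 1).mul (h 1 0)).mul (h 2 2))).add (((h 0 1).mul (h 1 2)).mul (h 2 0))).add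
    (((h 0 2).mul (h 1 0)).mul (h 2 1)) |>.sub (((h 0 2).mul (h 1 1)).mul (h 2 0))

/-- The basis `orientedBasis o x` is chosen point by point and need not vary continuously. A smooth
oriented frame `Y` replaces it, through Gram determinants, which are smooth. -/
theorem contMDiffAt_volForm (g : RiemMetric M) (o : MfdOrientation M) {Z : Fin 3 → ∀ x : M, T x}
    {p : M} (hZ : ∀ i, SmoothFieldAt (Z i) p) :
    ContMDiffAt (𝓡∂ 3) 𝓘(ℝ, ℝ) ∞ (fun x => volForm g o x fun i => Z i x) p := by
  obtain ⟨Y, hY, hb⟩ := o.exists_frame p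
  have key : ∀ᶠ x in 𝓝 p, volForm g o x (fun i => Z i x) =
      (Matrix.of fun i j => g.inner x (Y i x) (Z j x)).det *
        (√(Matrix.of fun i j => g.inner x (Y i x) (Y j x)).det)⁻¹ := by
    filter_upwards [hb] with x ⟨b, hbY, hbo⟩
    have hpos : 0 < (orientedBasis o x).det (fun i => Y i x) := by
      rw [← orientedBasis_orientation o x] at hbo
      have := (Module.Basis.orientation_eq_iff_det_pos _ _).1 hbo.symm
      rwa [show (fun i => Y i x) = b from funext fun i => (hbY i).symm]
    exact (sqrt_gram_mul_det (G := g.inner x) (g.pos x) (g.symm x) (orientedBasis o x) hpos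
      fun i => Z i x).trans (div_eq_mul_inv _ _)
  have hD : 0 < (Matrix.of fun i j => g.inner p (Y i p) (Y j p)).det := by
    obtain ⟨b, hbY, -⟩ := hb.self_of_nhds
    simp only [← hbY]
    exact det_gram_pos (G := g.inner p) (g.pos p) (g.symm p) b
  refine ContMDiffAt.congr_of_eventuallyEq ?_ key
  refine (contMDiffAt_det fun i j => contMDiffAt_inner g (hY i) (hZ j)).mul ?_
  have h2 : ContDiffAt ℝ ∞ (fun t : ℝ => (√t)⁻¹)
      (Matrix.of fun i j => g.inner p (Y i p) (Y j p)).det :=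
    (Real.contDiffAt_sqrt hD.ne').inv (Real.sqrt_pos.2 hD).ne'
  exact ContMDiffAt.comp (g := fun t : ℝ => (√t)⁻¹) p h2.contMDiffAt (contMDiffAt_det fun i j => contMDiffAt_inner g (hY i) (hY j))

theorem contDiffWithinAt_chartForm_interior (g : RiemMetric M) (o : MfdOrientation M)
    {B : ∀ x : M, T x} {p : M} (hB : SmoothFieldAt B p) :
    ContDiffWithinAt ℝ ∞ (chartForm (fun x => interiorProduct (B x) (volForm g o x)) p)
      (range (𝓡∂ 3)) (extChartAt (𝓡∂ 3) p p) := by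
  refine contDiffWithinAt_chartForm fun X hX => ?_
  have := contMDiffAt_volForm g o (Z := Fin.cons B X) (p := p)
    (Fin.cases hB hX)
  convert this using 2 with x
  rw [interiorProduct_apply]
  congr 1
  funext i
  refine Fin.cases rfl (fun _ => rfl) i

end SmoothForms
-- Pullbacks and the exterior derivative
section Pullback
open Set Filter

variable {M : Type*} [TopologicalSpace M] [ChartedSpace (EuclideanHalfSpace 3) M]
  {W : Type*} [NormedAddCommGroup W] [NormedSpace ℝ W]

/-- The pullback of a differential form on `M` by a map from a normed space. -/
noncomputable def pullForm {k : ℕ} (α : ∀ x : M, T x [⋀^Fin k]→L[ℝ] ℝ) (φ : W → M) (w : W) :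
    W [⋀^Fin k]→L[ℝ] ℝ :=
  (α (φ w)).compContinuousLinearMap (mfderiv 𝓘(ℝ, W) (𝓡∂ 3) φ w :)

theorem pullForm_apply {k : ℕ} (α : ∀ x : M, T x [⋀^Fin k]→L[ℝ] ℝ) (φ : W → M) (w : W)
    (v : Fin k → W) :
    pullForm α φ w v = α (φ w) (fun j => mfderiv 𝓘(ℝ, W) (𝓡∂ 3) φ w (v j)) := rfl

/-- Functoriality of the pullback, for a reparametrization of the domain. -/
theorem pullForm_apply_of_eventuallyEq_comp {k : ℕ} (α : ∀ x : M, T x [⋀^Fin k]→L[ℝ] ℝ)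
    {φ φ' : W → M} {τ : W → W} {w : W} (h : φ =ᶠ[𝓝 w] φ' ∘ τ) (hτ : DifferentiableAt ℝ τ w)
    (hφ' : MDifferentiableAt 𝓘(ℝ, W) (𝓡∂ 3) φ' (τ w)) (v : Fin k → W) :
    pullForm α φ w v = pullForm α φ' (τ w) (fun j => fderiv ℝ τ w (v j)) := by
  have h1 := h.mfderiv_eq.trans (mfderiv_comp w hφ' hτ.mdifferentiableAt)
  rw [mfderiv_eq_fderiv] at h1
  have h2 : φ w = φ' (τ w) := h.self_of_nhds
  unfold pullForm
  rw [h1]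
  change α (φ w) (fun j => mfderiv 𝓘(ℝ, W) (𝓡∂ 3) φ' (τ w) (fderiv ℝ τ w (v j)) : Fin k → E3) =
    α (φ' (τ w)) (fun j => mfderiv 𝓘(ℝ, W) (𝓡∂ 3) φ' (τ w) (fderiv ℝ τ w (v j)) : Fin k → E3)
  generalize (fun j => mfderiv 𝓘(ℝ, W) (𝓡∂ 3) φ' (τ w) (fderiv ℝ τ w (v j)) : Fin k → E3) = u
  rw [h2]

variable {φ : W → M} {w₀ : W} [IsManifold (𝓡∂ 3) ∞ M]

omit [IsManifold (𝓡∂ 3) ∞ M] in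
theorem contDiffAt_extChartAt_comp (hφ : ContMDiffAt 𝓘(ℝ, W) (𝓡∂ 3) ∞ φ w₀) :
    ContDiffAt ℝ ∞ (extChartAt (𝓡∂ 3) (φ w₀) ∘ φ) w₀ :=
  ((contMDiffAt_extChartAt (I := 𝓡∂ 3) (n := ∞) (x := φ w₀)).comp w₀ hφ).contDiffAt

theorem eventually_mdifferentiableAt (hφ : ContMDiffAt 𝓘(ℝ, W) (𝓡∂ 3) ∞ φ w₀) :
    ∀ᶠ w in 𝓝 w₀, MDifferentiableAt 𝓘(ℝ, W) (𝓡∂ 3) φ w := by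
  have : IsManifold (𝓡∂ 3) 1 M := IsManifold.of_le (n := ∞) (by simp)
  have h1 : ContMDiffAt 𝓘(ℝ, W) (𝓡∂ 3) 1 φ w₀ := hφ.of_le (by simp)
  filter_upwards [(contMDiffAt_iff_contMDiffAt_nhds (by simp)).1 h1] with w hw
  exact hw.mdifferentiableAt (by simp)

theorem eventually_chartField_fderiv (hφ : ContMDiffAt 𝓘(ℝ, W) (𝓡∂ 3) ∞ φ w₀) :
    ∀ᶠ w in 𝓝 w₀, φ w ∈ (extChartAt (𝓡∂ 3) (φ w₀)).source ∧ ∀ v,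
      chartField (φ w₀) (fderiv ℝ (extChartAt (𝓡∂ 3) (φ w₀) ∘ φ) w v) (φ w) =
        mfderiv 𝓘(ℝ, W) (𝓡∂ 3) φ w v := by
  filter_upwards [hφ.continuousAt.preimage_mem_nhds (extChartAt_source_mem_nhds (I := 𝓡∂ 3) (φ w₀)),
    eventually_mdifferentiableAt hφ] with w hw hφw
  refine ⟨hw, fun v => ?_⟩
  have hw' : φ w ∈ (chartAt (EuclideanHalfSpace 3) (φ w₀)).source := by
    rwa [mem_preimage, extChartAt_source] at hw
  have h1 : fderiv ℝ (extChartAt (𝓡∂ 3) (φ w₀) ∘ φ) w v =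
      mfderiv (𝓡∂ 3) 𝓘(ℝ, E3) (extChartAt (𝓡∂ 3) (φ w₀)) (φ w)
        (mfderiv 𝓘(ℝ, W) (𝓡∂ 3) φ w v) := by
    rw [← mfderiv_eq_fderiv]
    exact mfderiv_comp_apply w (mdifferentiableAt_extChartAt hw')
      hφw v
  have h2 := Bundle.Trivialization.symmL_continuousLinearMapAt (R := ℝ)
    (trivializationAt E3 (TangentSpace (𝓡∂ 3)) (φ w₀)) (b := φ w) (by simpa using hw')
    (mfderiv 𝓘(ℝ, W) (𝓡∂ 3) φ w v)
  rw [TangentBundle.continuousLinearMapAt_trivializationAt hw'] at h2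
  exact (congrArg (fun u => chartField (φ w₀) u (φ w)) h1).trans h2

/-- Differentiating at `w₀` requires a formula on a whole neighbourhood in one fixed chart, here the
one at `φ w₀`. -/
theorem pullForm_eventuallyEq {k : ℕ} (α : ∀ x : M, T x [⋀^Fin k]→L[ℝ] ℝ)
    (hφ : ContMDiffAt 𝓘(ℝ, W) (𝓡∂ 3) ∞ φ w₀) :
    pullForm α φ =ᶠ[𝓝 w₀] fun w => (chartForm α (φ w₀)
      ((extChartAt (𝓡∂ 3) (φ w₀) ∘ φ) w)).compContinuousLinearMap
        (fderiv ℝ (extChartAt (𝓡∂ 3) (φ w₀) ∘ φ) w) := by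
  filter_upwards [eventually_chartField_fderiv hφ] with w ⟨hw, h⟩
  ext v
  rw [ContinuousAlternatingMap.compContinuousLinearMap_apply, Function.comp_apply,
    chartForm_apply _ _ ((extChartAt (𝓡∂ 3) (φ w₀)).map_source hw),
    (extChartAt (𝓡∂ 3) (φ w₀)).left_inv hw, pullForm_apply]
  congr 1
  funext j
  exact (h (v j)).symm

theorem contDiffAt_pullForm [FiniteDimensional ℝ W] {k : ℕ}
    {α : ∀ x : M, T x [⋀^Fin k]→L[ℝ] ℝ}
    (hφ : ContMDiffAt 𝓘(ℝ, W) (𝓡∂ 3) ∞ φ w₀)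
    (hα : ContDiffWithinAt ℝ ∞ (chartForm α (φ w₀)) (range (𝓡∂ 3))
      (extChartAt (𝓡∂ 3) (φ w₀) (φ w₀))) :
    ContDiffAt ℝ ∞ (pullForm α φ) w₀ := by
  refine ContDiffAt.congr_of_eventuallyEq ?_ (pullForm_eventuallyEq α hφ)
  have hη := contDiffAt_extChartAt_comp hφ
  set η := extChartAt (𝓡∂ 3) (φ w₀) ∘ φ
  refine contDiffWithinAt_of_forall_apply fun v => ?_
  let b := (EuclideanSpace.basisFun (Fin 3) ℝ).toBasis
  -- Multilinear expansion in the standard basis separates the coefficients of the form from the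
  -- derivatives of `η`.
  have hexp : ∀ w, (chartForm α (φ w₀) (η w)).compContinuousLinearMap (fderiv ℝ η w) v =
      ∑ I : Fin k → Fin 3, (∏ j, fderiv ℝ η w (v j) (I j)) •
        chartForm α (φ w₀) (η w) (fun j => b (I j)) := by
    intro w
    rw [ContinuousAlternatingMap.compContinuousLinearMap_apply]
    have : (fderiv ℝ η w ∘ v) = fun j => ∑ i, fderiv ℝ η w (v j) i • b i := by
      funext j
      exact (b.sum_repr (fderiv ℝ η w (v j))).symm
    rw [this]
    have h1 := (chartForm α (φ w₀) (η w)).toMultilinearMap.map_sum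
      (fun j i => fderiv ℝ η w (v j) i • b i)
    refine h1.trans (Finset.sum_congr rfl fun I _ => ?_)
    exact (chartForm α (φ w₀) (η w)).toMultilinearMap.map_smul_univ _ _
  simp only [hexp]
  refine ContDiffWithinAt.sum fun I _ => ?_
  simp only [smul_eq_mul]
  refine ContDiffWithinAt.mul ?_ ?_
  · refine contDiffWithinAt_prod fun j _ => ?_
    have h1 : ContDiffAt ℝ ∞ (fun w => fderiv ℝ η w (v j)) w₀ :=
      (hη.fderiv_right (m := ∞) (by simp)).clm_apply contDiffAt_const
    exact (contDiffAt_euclidean.1 h1 (I j)).contDiffWithinAt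
  · have h1 : ContDiffWithinAt ℝ ∞ (fun y => chartForm α (φ w₀) y (fun j => b (I j)))
        (range (𝓡∂ 3)) (η w₀) :=
      (ContinuousAlternatingMap.apply ℝ E3 ℝ fun j => b (I j)).contDiff.comp_contDiffWithinAt hα
    exact h1.comp w₀ hη.contDiffWithinAt fun w _ => mem_range_self _

/-- Naturality of `d`. The chart form is differentiable only within the half-space, which is enough
because `η` takes its values there. -/
theorem extDeriv_pullForm {k : ℕ} {α : ∀ x : M, T x [⋀^Fin k]→L[ℝ] ℝ}
    (hφ : ContMDiffAt 𝓘(ℝ, W) (𝓡∂ 3) ∞ φ w₀)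
    (hα : ContDiffWithinAt ℝ ∞ (chartForm α (φ w₀)) (range (𝓡∂ 3))
      (extChartAt (𝓡∂ 3) (φ w₀) (φ w₀))) (v : Fin (k + 1) → W) :
    extDeriv (pullForm α φ) w₀ v =
      extDerivForm α (φ w₀) (fun j => mfderiv 𝓘(ℝ, W) (𝓡∂ 3) φ w₀ (v j)) := by
  have hη := contDiffAt_extChartAt_comp hφ
  have hmaps : MapsTo (extChartAt (𝓡∂ 3) (φ w₀) ∘ φ) univ (range (𝓡∂ 3)) :=
    fun w _ => mem_range_self _
  rw [(pullForm_eventuallyEq α hφ).extDeriv_eq, ← extDerivWithin_univ]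
  simp only [← fderivWithin_univ]
  rw [extDerivWithin_pullback (r := 2) (f := extChartAt (𝓡∂ 3) (φ w₀) ∘ φ)
    (hα.differentiableWithinAt (by simp)) (hη.of_le (WithTop.coe_le_coe.2 le_top)).contDiffWithinAt
    (by simp) uniqueDiffOn_univ (by simp) trivial hmaps,
    ContinuousAlternatingMap.compContinuousLinearMap_apply, fderivWithin_univ]
  refine congrArg (extDerivWithin (chartForm α (φ w₀)) (range (𝓡∂ 3))
    (extChartAt (𝓡∂ 3) (φ w₀) (φ w₀))) (funext fun j => ?_)
  rw [Function.comp_apply, ← mfderiv_eq_fderiv]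
  exact mfderiv_comp_apply w₀ (mdifferentiableAt_extChartAt (mem_chart_source _ _))
    (hφ.mdifferentiableAt (by simp)) (v j)

end Pullback
-- Curl and divergence at a point
section PointwiseFields
variable {M : Type*} [TopologicalSpace M] [ChartedSpace (EuclideanHalfSpace 3) M]
  [IsManifold (𝓡∂ 3) ∞ M] {g : RiemMetric M} {o : MfdOrientation M} {x : M}

theorem gramVolume_pos (g : RiemMetric M) (o : MfdOrientation M) (x : M) : 0 < gramVolume g o x :=
  Real.sqrt_pos.2 (det_gram_pos (G := g.inner x) (g.pos x) (g.symm x) (orientedBasis o x))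

theorem volForm_eq (g : RiemMetric M) (o : MfdOrientation M) (x : M) (Z : Fin 3 → T x) :
    volForm g o x Z = gramVolume g o x * (orientedBasis o x).det Z := rfl

/-- The volume form vanishes on triples of vectors in a plane. -/
theorem volForm_eq_zero_of_ker {r : T x →ₗ[ℝ] ℝ} (hr : r ≠ 0) {Z : Fin 3 → T x}
    (hZ : ∀ i, r (Z i) = 0) : volForm g o x Z = 0 := by
  rw [volForm_eq]
  by_contra h
  have hdet := right_ne_zero_of_mul h
  have hspan := ((Module.Basis.is_basis_iff_det (orientedBasis o x)).2 hdet.isUnit).2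
  exact hr (LinearMap.ext_on_range hspan hZ)

theorem not_linearIndependent_of_volForm_eq_zero {Z : Fin 3 → T x}
    (hZ : volForm g o x Z = 0) : ¬ LinearIndependent ℝ Z := by
  intro h
  rw [volForm_eq] at hZ
  have hdet := (mul_eq_zero.1 hZ).resolve_left (gramVolume_pos g o x).ne'
  have : FiniteDimensional ℝ (T x) := inferInstanceAs (FiniteDimensional ℝ E3)
  have hspan : Submodule.span ℝ (Set.range Z) = ⊤ :=
    h.span_eq_top_of_card_eq_finrank (by simp [Module.finrank_eq_card_basis (orientedBasis o x)])
  exact ((Module.Basis.is_basis_iff_det (orientedBasis o x)).1 ⟨h, hspan⟩).ne_zero hdet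

/-- The differential of `B♭` vanishes on planes tangent to the curl of `B`. -/
theorem extDerivForm_flat_eq_zero {B : ∀ x : M, T x} {r : T x →ₗ[ℝ] ℝ} (hr : r ≠ 0)
    (h : r (curl g o B x) = 0) {v w : T x} (hv : r v = 0) (hw : r w = 0) :
    extDerivForm (flat g B) x ![v, w] = 0 := by
  refine alternating_eq_zero_of_wedge_eq_zero (orientedBasis o x) _ r hr ?_ hv hw
  rw [curl, map_smul, smul_eq_mul, map_sum] at h
  simpa using (mul_eq_zero.1 h).resolve_left (inv_pos.2 (gramVolume_pos g o x)).ne'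

/-- A top-degree form is determined by its value on one basis, and the denominator in `divergence`
is the nonzero volume of that basis. -/
theorem extDerivForm_interior_eq_zero {B : ∀ x : M, T x} (h : divergence g o B x = 0) :
    extDerivForm (fun y => interiorProduct (B y) (volForm g o y)) x = 0 := by
  have hne : volForm g o x (orientedBasis o x) ≠ 0 := by
    rw [volForm_eq, Module.Basis.det_self, mul_one]
    exact (gramVolume_pos g o x).ne'
  have h0 := (div_eq_zero_iff.1 h).resolve_right hne
  have h1 := (AlternatingMap.map_basis_eq_zero_iff (orientedBasis o x)
    (extDerivForm (fun y => interiorProduct (B y) (volForm g o y)) x).toAlternatingMap).1 h0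
  ext v
  exact congrArg (fun β => β v) h1

end PointwiseFields

/-! ### Restricting forms on `ℝ² × ℝ` to horizontal slices -/

section Slices
open Set Filter

/-- The restriction of a one-form on `ℝ² × ℝ` to horizontal vectors. -/
noncomputable def horizontalPart (a : ((ℝ × ℝ) × ℝ) [⋀^Fin 1]→L[ℝ] ℝ) : ℝ × ℝ →L[ℝ] ℝ :=
  ((ContinuousAlternatingMap.ofSubsingleton ℝ ((ℝ × ℝ) × ℝ) ℝ (0 : Fin 1)).symm a).comp
    (ContinuousLinearMap.inl ℝ (ℝ × ℝ) ℝ)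

theorem horizontalPart_apply (a : ((ℝ × ℝ) × ℝ) [⋀^Fin 1]→L[ℝ] ℝ) (v : ℝ × ℝ) :
    horizontalPart a v = a ![(v, 0)] := by
  change a _ = a _
  congr 1
  funext i
  fin_cases i
  rfl

/-- The horizontal part of the contraction of a two-form on `ℝ² × ℝ` with the vertical vector. -/
noncomputable def normalPart (a : ((ℝ × ℝ) × ℝ) [⋀^Fin 2]→L[ℝ] ℝ) : ℝ × ℝ →L[ℝ] ℝ :=
  horizontalPart (interiorProduct ((0, 1) : (ℝ × ℝ) × ℝ) a)

theorem normalPart_apply (a : ((ℝ × ℝ) × ℝ) [⋀^Fin 2]→L[ℝ] ℝ) (v : ℝ × ℝ) :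
    normalPart a v = a ![(0, 1), (v, 0)] := by
  rw [normalPart, horizontalPart_apply, interiorProduct_apply]

theorem contDiff_slice {k : ℕ} {a : (ℝ × ℝ) × ℝ → ((ℝ × ℝ) × ℝ) [⋀^Fin k]→L[ℝ] ℝ} {t : ℝ}
    (ha : ∀ u, ContDiffAt ℝ ∞ a (u, t)) (m : Fin k → (ℝ × ℝ) × ℝ) :
    ContDiff ℝ ∞ fun u => a (u, t) m := by
  refine contDiff_iff_contDiffAt.2 fun u => ?_
  have h1 : ContDiffAt ℝ ∞ (fun u : ℝ × ℝ => (u, t)) u := contDiffAt_id.prodMk contDiffAt_const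
  have h2 := (ContinuousAlternatingMap.apply ℝ ((ℝ × ℝ) × ℝ) ℝ m).contDiff.comp_contDiffAt u
    ((ha u).comp u h1)
  exact h2

theorem fderiv_slice {k : ℕ} {a : (ℝ × ℝ) × ℝ → ((ℝ × ℝ) × ℝ) [⋀^Fin k]→L[ℝ] ℝ} {t : ℝ} {u : ℝ × ℝ}
    (ha : DifferentiableAt ℝ a (u, t)) (m : Fin k → (ℝ × ℝ) × ℝ) (v : ℝ × ℝ) :
    fderiv ℝ (fun u => a (u, t) m) u v = fderiv ℝ (fun w => a w m) (u, t) (v, 0) := by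
  have h1 : HasFDerivAt (fun u : ℝ × ℝ => (u, t)) (ContinuousLinearMap.inl ℝ (ℝ × ℝ) ℝ) u :=
    hasFDerivAt_prodMk_left u t
  have h2 : HasFDerivAt (fun w => a w m) (fderiv ℝ (fun w => a w m) (u, t)) (u, t) :=
    (ha.continuousAlternatingMap_apply_const m).hasFDerivAt
  exact congrArg (fun L => L v) (h2.comp u h1).fderiv

theorem contDiff_horizontalPart {a : (ℝ × ℝ) × ℝ → ((ℝ × ℝ) × ℝ) [⋀^Fin 1]→L[ℝ] ℝ} {t : ℝ}
    (ha : ∀ u, ContDiffAt ℝ ∞ a (u, t)) : ContDiff ℝ ∞ fun u => horizontalPart (a (u, t)) := by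
  refine contDiff_clm_apply_iff.2 fun v => ?_
  simp only [horizontalPart_apply]
  exact contDiff_slice ha _

theorem contDiff_normalPart {a : (ℝ × ℝ) × ℝ → ((ℝ × ℝ) × ℝ) [⋀^Fin 2]→L[ℝ] ℝ} {t : ℝ}
    (ha : ∀ u, ContDiffAt ℝ ∞ a (u, t)) : ContDiff ℝ ∞ fun u => normalPart (a (u, t)) := by
  refine contDiff_clm_apply_iff.2 fun v => ?_
  simp only [normalPart_apply]
  exact contDiff_slice ha _

theorem fderiv_apply_apply {α : ℝ × ℝ → ℝ × ℝ →L[ℝ] ℝ} (hα : Differentiable ℝ α) (u v w : ℝ × ℝ) :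
    fderiv ℝ α u v w = fderiv ℝ (fun u => α u w) u v := by
  rw [fderiv_clm_apply (hα u) (differentiableAt_const w)]
  simp

/-- On horizontal vectors, `da` is the exterior derivative of the restriction to the slice, whose
vanishing is the symmetry of the derivative. -/
theorem fderiv_horizontalPart_symm {a : (ℝ × ℝ) × ℝ → ((ℝ × ℝ) × ℝ) [⋀^Fin 1]→L[ℝ] ℝ} {t : ℝ}
    (ha : ∀ u, ContDiffAt ℝ ∞ a (u, t))
    (hd : ∀ u v w, extDeriv a (u, t) ![(v, 0), (w, 0)] = 0) (u v w : ℝ × ℝ) :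
    fderiv ℝ (fun u => horizontalPart (a (u, t))) u v w =
      fderiv ℝ (fun u => horizontalPart (a (u, t))) u w v := by
  have hdiff := (contDiff_horizontalPart ha).differentiable (by simp)
  have hau := (ha u).differentiableAt (by simp)
  rw [fderiv_apply_apply hdiff, fderiv_apply_apply hdiff]
  simp only [horizontalPart_apply]
  rw [fderiv_slice hau, fderiv_slice hau]
  have h := hd u v w
  rw [extDeriv_apply hau, Fin.sum_univ_two] at h
  have e0 : (0 : Fin 2).removeNth ![((v, 0) : (ℝ × ℝ) × ℝ), (w, 0)] = ![(w, 0)] := by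
    funext i; fin_cases i; rfl
  have e1 : (1 : Fin 2).removeNth ![((v, 0) : (ℝ × ℝ) × ℝ), (w, 0)] = ![(v, 0)] := by
    funext i; fin_cases i; rfl
  rw [e0, e1] at h
  simp at h
  linarith

/-- In `da(∂ₜ, v, w)` the term `∂ₜ(a(v, w))` drops out because `a` kills horizontal pairs near the
slice and not only on it. The other two terms are the exterior derivative of the normal part. -/
theorem fderiv_normalPart_symm {a : (ℝ × ℝ) × ℝ → ((ℝ × ℝ) × ℝ) [⋀^Fin 2]→L[ℝ] ℝ} {t : ℝ}
    (ha : ∀ u, ContDiffAt ℝ ∞ a (u, t)) (hd : ∀ u, extDeriv a (u, t) = 0)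
    (hz : ∀ u, ∀ᶠ x in 𝓝 (u, t), ∀ v w, a x ![(v, 0), (w, 0)] = 0) (u v w : ℝ × ℝ) :
    fderiv ℝ (fun u => normalPart (a (u, t))) u v w =
      fderiv ℝ (fun u => normalPart (a (u, t))) u w v := by
  have hdiff := (contDiff_normalPart ha).differentiable (by simp)
  have hau := (ha u).differentiableAt (by simp)
  rw [fderiv_apply_apply hdiff, fderiv_apply_apply hdiff]
  simp only [normalPart_apply]
  rw [fderiv_slice hau, fderiv_slice hau]
  have h : extDeriv a (u, t) ![((0, 1) : (ℝ × ℝ) × ℝ), (v, 0), (w, 0)] = 0 := by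
    rw [hd u]
    rfl
  rw [extDeriv_apply hau, Fin.sum_univ_three] at h
  have e0 : (0 : Fin 3).removeNth ![((0, 1) : (ℝ × ℝ) × ℝ), (v, 0), (w, 0)] =
      ![(v, 0), (w, 0)] := by
    funext i; fin_cases i <;> rfl
  have e1 : (1 : Fin 3).removeNth ![((0, 1) : (ℝ × ℝ) × ℝ), (v, 0), (w, 0)] =
      ![(0, 1), (w, 0)] := by
    funext i; fin_cases i <;> rfl
  have e2 : (2 : Fin 3).removeNth ![((0, 1) : (ℝ × ℝ) × ℝ), (v, 0), (w, 0)] =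
      ![(0, 1), (v, 0)] := by
    funext i; fin_cases i <;> rfl
  rw [e0, e1, e2] at h
  have hz' : (fun x => a x ![((v, 0) : (ℝ × ℝ) × ℝ), (w, 0)]) =ᶠ[𝓝 (u, t)] fun _ => 0 := by
    filter_upwards [hz u] with x hx using hx v w
  rw [hz'.fderiv_eq] at h
  simp at h
  linarith

end Slices

/-! ### The coframe on a level sphere -/

section FieldSlices
open Set Filter

variable {M : Type*} [TopologicalSpace M] [ChartedSpace (EuclideanHalfSpace 3) M]
  [IsManifold (𝓡∂ 3) ∞ M] {g : RiemMetric M} {o : MfdOrientation M} {B : ∀ x : M, T x}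
  {ρ : M → ℝ} {φ : (ℝ × ℝ) × ℝ → M} {t c : ℝ}

/-- A parametrization of `M` near a family of level sets of `ρ` by the plane. -/
structure IsSlicing (ρ : M → ℝ) (φ : (ℝ × ℝ) × ℝ → M) (t c : ℝ) : Prop where
  contMDiffAt : ∀ u, ContMDiffAt 𝓘(ℝ, (ℝ × ℝ) × ℝ) (𝓡∂ 3) ∞ φ (u, t)
  eventually_eq : ∀ u, ∀ᶠ w in 𝓝 (u, t), ρ (φ w) = w.2 + c
  injective : ∀ u, Function.Injective (mfderiv 𝓘(ℝ, (ℝ × ℝ) × ℝ) (𝓡∂ 3) φ (u, t))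

theorem IsSlicing.eventually_mfderiv (hφ : IsSlicing ρ φ t c)
    (hρ : ContMDiff (𝓡∂ 3) 𝓘(ℝ, ℝ) ∞ ρ) (u : ℝ × ℝ) :
    ∀ᶠ w in 𝓝 (u, t), ∀ v, (mfderiv (𝓡∂ 3) 𝓘(ℝ, ℝ) ρ (φ w) : T (φ w) →L[ℝ] ℝ)
      (mfderiv 𝓘(ℝ, (ℝ × ℝ) × ℝ) (𝓡∂ 3) φ w v) = v.2 := by
  filter_upwards [eventually_mdifferentiableAt (hφ.contMDiffAt u),
    (hφ.eventually_eq u).eventually_nhds] with w hw hρw v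
  have h1 : mfderiv 𝓘(ℝ, (ℝ × ℝ) × ℝ) 𝓘(ℝ, ℝ) (ρ ∘ φ) w v = v.2 := by
    rw [mfderiv_eq_fderiv]
    have h2 : ρ ∘ φ =ᶠ[𝓝 w] fun w => w.2 + c := hρw
    rw [h2.fderiv_eq, fderiv_add_const, fderiv_snd]
    rfl
  rw [← h1]
  exact (mfderiv_comp_apply w ((hρ (φ w)).mdifferentiableAt (by simp)) hw v).symm

omit [IsManifold (𝓡∂ 3) ∞ M] in
variable (ρ) in
/-- The differential of a function, as a linear form on the tangent space. -/
noncomputable def differential (x : M) : T x →ₗ[ℝ] ℝ :=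
  let r : T x →L[ℝ] ℝ := mfderiv (𝓡∂ 3) 𝓘(ℝ, ℝ) ρ x
  r.toLinearMap

theorem IsSlicing.differential_ne_zero (hφ : IsSlicing ρ φ t c)
    (hρ : ContMDiff (𝓡∂ 3) 𝓘(ℝ, ℝ) ∞ ρ) (u : ℝ × ℝ) :
    ∀ᶠ w in 𝓝 (u, t), differential ρ (φ w) ≠ 0 := by
  filter_upwards [hφ.eventually_mfderiv hρ u] with w hw h0
  have h1 := hw (0, 1)
  have h2 := LinearMap.congr_fun h0 (mfderiv 𝓘(ℝ, (ℝ × ℝ) × ℝ) (𝓡∂ 3) φ w (0, 1))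
  exact one_ne_zero (α := ℝ) (h1.symm.trans h2)

theorem contDiffAt_pull_flat (hφ : IsSlicing ρ φ t c) (hB : IsSmoothField B) (u : ℝ × ℝ) :
    ContDiffAt ℝ ∞ (pullForm (flat g B) φ) (u, t) :=
  contDiffAt_pullForm (hφ.contMDiffAt u) (contDiffWithinAt_chartForm_flat g (hB _))

theorem contDiffAt_pull_interior (hφ : IsSlicing ρ φ t c) (hB : IsSmoothField B) (u : ℝ × ℝ) :
    ContDiffAt ℝ ∞ (pullForm (fun y => interiorProduct (B y) (volForm g o y)) φ) (u, t) :=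
  contDiffAt_pullForm (hφ.contMDiffAt u) (contDiffWithinAt_chartForm_interior g o (hB _))

theorem extDeriv_pull_flat (hφ : IsSlicing ρ φ t c) (hB : IsSmoothField B)
    (hρ : ContMDiff (𝓡∂ 3) 𝓘(ℝ, ℝ) ∞ ρ) (hcurl : IsFirstIntegral ρ (curl g o B))
    (u v w : ℝ × ℝ) : extDeriv (pullForm (flat g B) φ) (u, t) ![(v, 0), (w, 0)] = 0 := by
  rw [extDeriv_pullForm (hφ.contMDiffAt u) (contDiffWithinAt_chartForm_flat g (hB _))]
  have hr := (hφ.eventually_mfderiv hρ u).self_of_nhds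
  have h0 := extDerivForm_flat_eq_zero (hφ.differential_ne_zero hρ u).self_of_nhds (hcurl (φ (u, t)))
    (hr (v, 0)) (hr (w, 0))
  refine Eq.trans ?_ h0
  congr 1
  funext i
  fin_cases i <;> rfl

theorem extDeriv_pull_interior (hφ : IsSlicing ρ φ t c) (hB : IsSmoothField B)
    (hdiv : ∀ x, divergence g o B x = 0) (u : ℝ × ℝ) :
    extDeriv (pullForm (fun y => interiorProduct (B y) (volForm g o y)) φ) (u, t) = 0 := by
  ext v
  rw [extDeriv_pullForm (hφ.contMDiffAt u) (contDiffWithinAt_chartForm_interior g o (hB _)),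
    extDerivForm_interior_eq_zero (hdiv _)]
  rfl

theorem eventually_pull_interior_eq_zero (hφ : IsSlicing ρ φ t c)
    (hρ : ContMDiff (𝓡∂ 3) 𝓘(ℝ, ℝ) ∞ ρ) (hρB : IsFirstIntegral ρ B) (u : ℝ × ℝ) :
    ∀ᶠ x in 𝓝 (u, t), ∀ v w,
      pullForm (fun y => interiorProduct (B y) (volForm g o y)) φ x ![(v, 0), (w, 0)] = 0 := by
  filter_upwards [hφ.differential_ne_zero hρ u, hφ.eventually_mfderiv hρ u] with x hx hr v w
  rw [pullForm_apply, interiorProduct_apply]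
  refine volForm_eq_zero_of_ker hx fun i => ?_
  fin_cases i
  · exact hρB (φ x)
  · exact hr (v, 0)
  · exact hr (w, 0)

theorem horizontalPart_pull_flat (w : (ℝ × ℝ) × ℝ) (v : ℝ × ℝ) :
    horizontalPart (pullForm (flat g B) φ w) v =
      g.inner (φ w) (B (φ w)) (mfderiv 𝓘(ℝ, (ℝ × ℝ) × ℝ) (𝓡∂ 3) φ w (v, 0)) := by
  rw [horizontalPart_apply]
  rfl

/-- Equal dimensions make the differential of `φ` onto; `dρ(B) = 0` then kills the vertical
component. -/
theorem IsSlicing.exists_preimage (hφ : IsSlicing ρ φ t c)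
    (hρ : ContMDiff (𝓡∂ 3) 𝓘(ℝ, ℝ) ∞ ρ) (hρB : IsFirstIntegral ρ B) (u : ℝ × ℝ) :
    ∃ b : ℝ × ℝ, mfderiv 𝓘(ℝ, (ℝ × ℝ) × ℝ) (𝓡∂ 3) φ (u, t) (b, 0) = B (φ (u, t)) := by
  have hfin : Module.finrank ℝ ((ℝ × ℝ) × ℝ) = Module.finrank ℝ E3 := by simp
  let D : (ℝ × ℝ) × ℝ →ₗ[ℝ] E3 := ContinuousLinearMap.toLinearMap (M := (ℝ × ℝ) × ℝ) (M₂ := E3)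
    (mfderiv 𝓘(ℝ, (ℝ × ℝ) × ℝ) (𝓡∂ 3) φ (u, t))
  have hsurj : Function.Surjective D :=
    (LinearMap.injective_iff_surjective_of_finrank_eq_finrank hfin).1 (hφ.injective u)
  obtain ⟨⟨b, s⟩, hb⟩ := hsurj (B (φ (u, t)))
  have hs := (hφ.eventually_mfderiv hρ u).self_of_nhds (b, s)
  change _ = s at hs
  have : s = 0 := by
    rw [← hs]
    exact (congrArg (fun X : T (φ (u, t)) =>
      (mfderiv (𝓡∂ 3) 𝓘(ℝ, ℝ) ρ (φ (u, t)) : T (φ (u, t)) →L[ℝ] ℝ) X) hb).trans (hρB (φ (u, t)))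
  subst this
  exact ⟨b, hb⟩

/-- Since `B` comes from a horizontal vector, evaluating the form on it gives `g(B, B)`. -/
theorem IsSlicing.eq_zero_of_horizontalPart (hφ : IsSlicing ρ φ t c)
    (hρ : ContMDiff (𝓡∂ 3) 𝓘(ℝ, ℝ) ∞ ρ) (hρB : IsFirstIntegral ρ B) (u : ℝ × ℝ)
    (h : horizontalPart (pullForm (flat g B) φ (u, t)) = 0) : B (φ (u, t)) = 0 := by
  obtain ⟨b, hb⟩ := hφ.exists_preimage hρ hρB u
  by_contra hne
  refine (g.pos (φ (u, t)) (B (φ (u, t))) hne).ne' ?_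
  have := horizontalPart_pull_flat (g := g) (B := B) (φ := φ) (u, t) b
  rw [h, hb] at this
  exact this.symm

/-- Where `B ≠ 0`, `vol(B, ∂ₜ, v) = 0` makes `v` a multiple of the horizontal vector over `B`; then
`g(B, v) = 0` forces that multiple to be zero. -/
theorem IsSlicing.eq_zero_or_injective (hφ : IsSlicing ρ φ t c)
    (hρ : ContMDiff (𝓡∂ 3) 𝓘(ℝ, ℝ) ∞ ρ) (hρB : IsFirstIntegral ρ B) (u : ℝ × ℝ) :
    horizontalPart (pullForm (flat g B) φ (u, t)) = 0 ∨
      Function.Injective ((horizontalPart (pullForm (flat g B) φ (u, t))).prod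
        (normalPart (pullForm (fun y => interiorProduct (B y) (volForm g o y)) φ (u, t)))) := by
  obtain ⟨b, hb⟩ := hφ.exists_preimage hρ hρB u
  rcases eq_or_ne (B (φ (u, t))) 0 with h0 | hne
  · left
    refine ContinuousLinearMap.ext fun v => ?_
    simp [horizontalPart_pull_flat, h0]
  right
  refine (injective_iff_map_eq_zero _).2 fun v hv => ?_
  simp only [ContinuousLinearMap.prod_apply, Prod.mk_eq_zero] at hv
  obtain ⟨hv1, hv2⟩ := hv
  rw [horizontalPart_pull_flat] at hv1
  rw [normalPart_apply, pullForm_apply, interiorProduct_apply] at hv2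
  let D : (ℝ × ℝ) × ℝ →ₗ[ℝ] E3 := ContinuousLinearMap.toLinearMap (M := (ℝ × ℝ) × ℝ) (M₂ := E3)
    (mfderiv 𝓘(ℝ, (ℝ × ℝ) × ℝ) (𝓡∂ 3) φ (u, t))
  have hD : LinearMap.ker D = ⊥ := LinearMap.ker_eq_bot.2 (hφ.injective u)
  have hdep := not_linearIndependent_of_volForm_eq_zero hv2
  have hdep' : ¬ LinearIndependent ℝ ![((b, 0) : (ℝ × ℝ) × ℝ), (0, 1), (v, 0)] := by
    intro hli
    refine hdep ?_
    have hli' := hli.map' D hD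
    have heq : D ∘ ![((b, 0) : (ℝ × ℝ) × ℝ), (0, 1), (v, 0)] =
        (Matrix.vecCons (B (φ (u, t))) fun j => mfderiv 𝓘(ℝ, (ℝ × ℝ) × ℝ) (𝓡∂ 3) φ (u, t)
          (![((0, 1) : (ℝ × ℝ) × ℝ), (v, 0)] j) : Fin 3 → E3) := by
      funext i
      fin_cases i
      · exact hb
      · rfl
      · rfl
    rw [heq] at hli'
    exact hli'
  obtain ⟨k, hk, i, hi⟩ := Fintype.not_linearIndependent_iff.1 hdep'
  simp only [Fin.sum_univ_three, Matrix.cons_val_zero, Matrix.cons_val_one, Matrix.cons_val] at hk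
  -- Only the middle vector has a vertical component, so the dependence involves just `b` and `v`.
  have hk1 : k 1 = 0 := by simpa using congrArg Prod.snd hk
  have hk2 : k 0 • b + k 2 • v = 0 := by simpa using congrArg Prod.fst hk
  have hbne : b ≠ 0 := by
    rintro rfl
    refine hne (hb.symm.trans ?_)
    exact map_zero D
  have hk3 : k 2 ≠ 0 := by
    intro hk3
    rw [hk3, zero_smul, add_zero] at hk2
    have := (smul_eq_zero.1 hk2).resolve_right hbne
    fin_cases i
    · exact hi this
    · exact hi hk1
    · exact hi hk3
  have hvb : v = (-(k 2)⁻¹ * k 0) • b := by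
    have : k 2 • v = -(k 0 • b) := eq_neg_of_add_eq_zero_right hk2
    rw [mul_smul, neg_smul, ← smul_neg, ← this, smul_smul, inv_mul_cancel₀ hk3, one_smul]
  set m := -(k 2)⁻¹ * k 0
  have hDv : D (v, 0) = m • (B (φ (u, t)) : E3) := by
    rw [hvb, show ((m • b, 0) : (ℝ × ℝ) × ℝ) = m • (b, 0) by simp, map_smul]
    exact congrArg (fun X : E3 => m • X) hb
  have hm : m * g.inner (φ (u, t)) (B (φ (u, t))) (B (φ (u, t))) = 0 := by
    rw [← hv1]
    refine Eq.trans ?_ (congrArg (fun X : T (φ (u, t)) =>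
      g.inner (φ (u, t)) (B (φ (u, t))) X) hDv.symm)
    exact ((g.inner (φ (u, t)) (B (φ (u, t)))).map_smul m _).symm
  have := (mul_eq_zero.1 hm).resolve_right (g.pos (φ (u, t)) _ hne).ne'
  rw [hvb, this, zero_smul]

-- The change of parametrization is `planeInv` times the identity. It fixes the vertical vector, so
-- horizontal and normal parts both transform as one-forms on the sphere.
omit [IsManifold (𝓡∂ 3) ∞ M] in
theorem pullForm_glue {φ₁ φ₂ : (ℝ × ℝ) × ℝ → M} (hφ₂ : IsSlicing ρ φ₂ t c)
    (hglue : ∀ u ≠ 0, ∀ s, φ₁ (u, s) = φ₂ (planeInv u, s)) {k : ℕ}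
    (α : ∀ x : M, T x [⋀^Fin k]→L[ℝ] ℝ) {u : ℝ × ℝ} (hu : u ≠ 0) (v : Fin k → (ℝ × ℝ) × ℝ) :
    pullForm α φ₁ (u, t) v = pullForm α φ₂ (planeInv u, t)
      (fun j => (fderiv ℝ planeInv u (v j).1, (v j).2)) := by
  have hinv := (contDiffAt_planeInv hu).differentiableAt (by simp)
  have hτ : HasFDerivAt (fun w : (ℝ × ℝ) × ℝ => (planeInv w.1, w.2))
      (((fderiv ℝ planeInv u).comp (ContinuousLinearMap.fst ℝ (ℝ × ℝ) ℝ)).prod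
        (ContinuousLinearMap.snd ℝ (ℝ × ℝ) ℝ)) (u, t) :=
    (HasFDerivAt.comp (g := planeInv) (u, t) hinv.hasFDerivAt hasFDerivAt_fst).prodMk
      hasFDerivAt_snd
  have hev : φ₁ =ᶠ[𝓝 (u, t)] φ₂ ∘ fun w : (ℝ × ℝ) × ℝ => (planeInv w.1, w.2) := by
    filter_upwards [(continuous_fst (X := ℝ × ℝ) (Y := ℝ)).continuousAt.preimage_mem_nhds
      (isOpen_compl_singleton.mem_nhds hu)] with w hw
    exact hglue w.1 hw w.2
  rw [pullForm_apply_of_eventuallyEq_comp α hev hτ.differentiableAt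
    ((hφ₂.contMDiffAt (planeInv u)).mdifferentiableAt (by simp)), hτ.fderiv]
  rfl

/-- A divergence-free field tangent, with its curl, to a family of spheres vanishes on them. -/
theorem IsSlicing.eq_zero_of_glue {φ₁ φ₂ : (ℝ × ℝ) × ℝ → M} (hφ₁ : IsSlicing ρ φ₁ t c)
    (hφ₂ : IsSlicing ρ φ₂ t c) (hglue : ∀ u ≠ 0, ∀ s, φ₁ (u, s) = φ₂ (planeInv u, s))
    (hB : IsSmoothField B) (hdiv : ∀ x, divergence g o B x = 0)
    (hρ : ContMDiff (𝓡∂ 3) 𝓘(ℝ, ℝ) ∞ ρ) (hρB : IsFirstIntegral ρ B)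
    (hcurl : IsFirstIntegral ρ (curl g o B)) (u : ℝ × ℝ) : B (φ₁ (u, t)) = 0 := by
  refine hφ₁.eq_zero_of_horizontalPart (g := g) hρ hρB u ?_
  refine eq_zero_of_closed_coframe
    (α₁ := fun u => horizontalPart (pullForm (flat g B) φ₁ (u, t)))
    (α₂ := fun u => horizontalPart (pullForm (flat g B) φ₂ (u, t)))
    (β₁ := fun u => normalPart
      (pullForm (fun y => interiorProduct (B y) (volForm g o y)) φ₁ (u, t)))
    (β₂ := fun u => normalPart
      (pullForm (fun y => interiorProduct (B y) (volForm g o y)) φ₂ (u, t)))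
    (contDiff_horizontalPart (contDiffAt_pull_flat hφ₁ hB))
    (contDiff_horizontalPart (contDiffAt_pull_flat hφ₂ hB))
    (contDiff_normalPart (contDiffAt_pull_interior hφ₁ hB))
    (contDiff_normalPart (contDiffAt_pull_interior hφ₂ hB))
    (fderiv_horizontalPart_symm (contDiffAt_pull_flat hφ₁ hB)
      (extDeriv_pull_flat hφ₁ hB hρ hcurl))
    (fderiv_horizontalPart_symm (contDiffAt_pull_flat hφ₂ hB)
      (extDeriv_pull_flat hφ₂ hB hρ hcurl))
    (fderiv_normalPart_symm (contDiffAt_pull_interior hφ₁ hB)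
      (extDeriv_pull_interior hφ₁ hB hdiv) (eventually_pull_interior_eq_zero hφ₁ hρ hρB))
    (fderiv_normalPart_symm (contDiffAt_pull_interior hφ₂ hB)
      (extDeriv_pull_interior hφ₂ hB hdiv) (eventually_pull_interior_eq_zero hφ₂ hρ hρB))
    (fun x hx => ?_) (fun x hx => ?_) (fun x => hφ₁.eq_zero_or_injective hρ hρB x) u
  · refine ContinuousLinearMap.ext fun v => ?_
    rw [ContinuousLinearMap.comp_apply, horizontalPart_apply, horizontalPart_apply,
      pullForm_glue hφ₂ hglue _ hx]
    congr 1
    funext i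
    fin_cases i
    rfl
  · refine ContinuousLinearMap.ext fun v => ?_
    rw [ContinuousLinearMap.comp_apply, normalPart_apply, normalPart_apply,
      pullForm_glue hφ₂ hglue _ hx]
    congr 1
    funext i
    fin_cases i
    · simp
    · rfl

end FieldSlices
-- Stereographic and polar coordinates
section Stereographic
open Set Filter

/-- The inverse stereographic projections from the two poles `(0, 0, ε)`, `ε = ±1`. -/
noncomputable def stereoInv (ε : ℝ) (u : ℝ × ℝ) : E3 :=
  (1 + (u.1 ^ 2 + u.2 ^ 2))⁻¹ • !₂[2 * u.1, 2 * u.2, ε * (u.1 ^ 2 + u.2 ^ 2 - 1)]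

theorem contDiff_stereoInv (ε : ℝ) : ContDiff ℝ ∞ (stereoInv ε) := by
  have h : ContDiff ℝ ∞ fun u : ℝ × ℝ => u.1 ^ 2 + u.2 ^ 2 :=
    (contDiff_fst.pow 2).add (contDiff_snd.pow 2)
  refine ((contDiff_const.add h).inv fun u => ?_).smul (contDiff_euclidean.2 fun i => ?_)
  · positivity
  · fin_cases i
    · exact contDiff_const.mul contDiff_fst
    · exact contDiff_const.mul contDiff_snd
    · exact contDiff_const.mul (h.sub contDiff_const)

theorem norm_stereoInv {ε : ℝ} (hε : ε ^ 2 = 1) (u : ℝ × ℝ) : ‖stereoInv ε u‖ = 1 := by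
  have hpos : 0 < 1 + (u.1 ^ 2 + u.2 ^ 2) := by positivity
  have h : ‖(!₂[2 * u.1, 2 * u.2, ε * (u.1 ^ 2 + u.2 ^ 2 - 1)] : E3)‖ =
      1 + (u.1 ^ 2 + u.2 ^ 2) := by
    rw [EuclideanSpace.norm_eq, Real.sqrt_eq_iff_mul_self_eq_of_pos hpos]
    simp only [Real.norm_eq_abs, sq_abs, Fin.sum_univ_three]
    simp
    linear_combination -(u.1 ^ 2 + u.2 ^ 2 - 1) ^ 2 * hε
  rw [stereoInv, norm_smul, h, norm_inv, Real.norm_of_nonneg hpos.le, inv_mul_cancel₀ hpos.ne']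

theorem stereoInv_planeInv {u : ℝ × ℝ} (hu : u ≠ 0) (ε : ℝ) :
    stereoInv ε u = stereoInv (-ε) (planeInv u) := by
  have h := sq_add_sq_pos hu
  have h1 : 0 < 1 + (u.1 ^ 2 + u.2 ^ 2) := by positivity
  ext i
  fin_cases i <;> simp [stereoInv, planeInv] <;> field_simp <;> ring

theorem exists_stereoInv_eq {z : E3} (hz : ‖z‖ = 1) :
    (∃ u, stereoInv 1 u = z) ∨ ∃ u, stereoInv (-1) u = z := by
  have hz2 : z 0 ^ 2 + z 1 ^ 2 + z 2 ^ 2 = 1 := by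
    have := EuclideanSpace.norm_sq_eq z
    rw [hz] at this
    simp [Fin.sum_univ_three] at this
    exact this.symm
  -- Stereographic projection from `(0, 0, ε)` reaches every point with `z 2 ≠ ε`, so the two poles
  -- together cover the sphere.
  have key : ∀ ε : ℝ, ε ^ 2 = 1 → 1 - ε * z 2 ≠ 0 → ∃ u, stereoInv ε u = z := by
    intro ε hε h
    refine ⟨(z 0 / (1 - ε * z 2), z 1 / (1 - ε * z 2)), ?_⟩
    have hsq : (z 0 / (1 - ε * z 2)) ^ 2 + (z 1 / (1 - ε * z 2)) ^ 2 =
        (1 + ε * z 2) / (1 - ε * z 2) := by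
      field_simp
      linear_combination hz2 + z 2 ^ 2 * hε
    have hsum : 1 + (1 + ε * z 2) / (1 - ε * z 2) = 2 / (1 - ε * z 2) := by
      field_simp
      ring
    ext i
    fin_cases i <;> simp [stereoInv, hsq, hsum] <;> field_simp
    linear_combination 2 * z 2 * hε
  by_cases h : 1 - 1 * z 2 = 0
  · right
    refine key (-1) (by norm_num) ?_
    intro h'
    linarith
  · exact Or.inl (key 1 (by norm_num) h)

/-- The polar coordinates of space given by a stereographic projection are regular. -/
theorem injective_fderiv_polar {ε : ℝ} (hε : ε ^ 2 = 1) {u : ℝ × ℝ} {s : ℝ} (hs : 0 < 1 + s) :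
    Function.Injective (fderiv ℝ
      (fun w : (ℝ × ℝ) × ℝ => (1 + w.2) • stereoInv ε w.1) (u, s)) := by
  set Φ := fun w : (ℝ × ℝ) × ℝ => (1 + w.2) • stereoInv ε w.1
  have hΦ : DifferentiableAt ℝ Φ (u, s) := by
    have h1 : ContDiff ℝ ∞ Φ := (contDiff_const.add contDiff_snd).smul
      ((contDiff_stereoInv ε).comp contDiff_fst)
    exact h1.differentiable (by simp) _
  have hden : ∀ (v : ℝ × ℝ), 1 + (v.1 ^ 2 + v.2 ^ 2) ≠ 0 := fun v => by positivity
  -- The explicit inverse: stereographic projection of the direction, together with the radius minus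
  -- one. By the chain rule its differential is a left inverse.
  let Λ : E3 → (ℝ × ℝ) × ℝ := fun y =>
    ((y 0 / (‖y‖ - ε * y 2), y 1 / (‖y‖ - ε * y 2)), ‖y‖ - 1)
  have hnorm : ∀ w : (ℝ × ℝ) × ℝ, 0 < 1 + w.2 → ‖Φ w‖ = 1 + w.2 := fun w hw => by
    rw [norm_smul, norm_stereoInv hε, mul_one, Real.norm_of_nonneg hw.le]
  have hd : ∀ w : (ℝ × ℝ) × ℝ, 0 < 1 + w.2 →
      ‖Φ w‖ - ε * Φ w 2 = 2 * (1 + w.2) / (1 + (w.1.1 ^ 2 + w.1.2 ^ 2)) := fun w hw => by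
    have := hden w.1
    rw [hnorm w hw]
    simp [Φ, stereoInv]
    field_simp
    linear_combination (1 - w.1.1 ^ 2 - w.1.2 ^ 2) * hε
  have hleft : ∀ w : (ℝ × ℝ) × ℝ, 0 < 1 + w.2 → Λ (Φ w) = w := fun w hw => by
    have h1 := hden w.1
    refine Prod.ext (Prod.ext ?_ ?_) ?_
    · change Φ w 0 / (‖Φ w‖ - ε * Φ w 2) = w.1.1
      rw [hd w hw]
      simp [Φ, stereoInv]
      field_simp
    · change Φ w 1 / (‖Φ w‖ - ε * Φ w 2) = w.1.2
      rw [hd w hw]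
      simp [Φ, stereoInv]
      field_simp
    · change ‖Φ w‖ - 1 = w.2
      rw [hnorm w hw]
      ring
  have hne : Φ (u, s) ≠ 0 := norm_pos_iff.1 (by rw [hnorm _ hs]; exact hs)
  have hΛ : DifferentiableAt ℝ Λ (Φ (u, s)) := by
    have hn : DifferentiableAt ℝ (fun y : E3 => ‖y‖) (Φ (u, s)) :=
      differentiableAt_id.norm ℝ hne
    have hc : ∀ i : Fin 3, DifferentiableAt ℝ (fun y : E3 => y i) (Φ (u, s)) := fun i =>
      (EuclideanSpace.proj i : E3 →L[ℝ] ℝ).differentiableAt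
    have hd0 : (fun y : E3 => ‖y‖ - ε * y 2) (Φ (u, s)) ≠ 0 := by
      refine (hd _ hs).trans_ne ?_
      have := hden u
      positivity
    have hdd : DifferentiableAt ℝ (fun y : E3 => ‖y‖ - ε * y 2) (Φ (u, s)) :=
      hn.sub ((hc 2).const_mul ε)
    have h0 : DifferentiableAt ℝ (fun y : E3 => y 0 / (‖y‖ - ε * y 2)) (Φ (u, s)) :=
      (hc 0).fun_mul (hdd.fun_inv hd0)
    have h1 : DifferentiableAt ℝ (fun y : E3 => y 1 / (‖y‖ - ε * y 2)) (Φ (u, s)) :=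
      (hc 1).fun_mul (hdd.fun_inv hd0)
    exact (h0.prodMk h1).prodMk (hn.sub_const 1)
  have hcomp : Λ ∘ Φ =ᶠ[𝓝 (u, s)] id := by
    have : ∀ᶠ w : (ℝ × ℝ) × ℝ in 𝓝 (u, s), 0 < 1 + w.2 :=
      (continuous_const.add continuous_snd).continuousAt.eventually (lt_mem_nhds hs)
    filter_upwards [this] with w hw using hleft w hw
  have hfd : (fderiv ℝ Λ (Φ (u, s))).comp (fderiv ℝ Φ (u, s)) =
      ContinuousLinearMap.id ℝ ((ℝ × ℝ) × ℝ) :=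
    (fderiv_comp _ hΛ hΦ).symm.trans (hcomp.fderiv_eq.trans fderiv_id)
  have hli : Function.LeftInverse (fderiv ℝ Λ (Φ (u, s))) (fderiv ℝ Φ (u, s)) := fun v =>
    congrArg (fun L : ((ℝ × ℝ) × ℝ) →L[ℝ] ((ℝ × ℝ) × ℝ) => L v) hfd
  exact hli.injective

end Stereographic

/-! ### Inverse function theorems, also on convex sets -/

section InverseFunction
open Set Filter

variable {E F : Type*} [NormedAddCommGroup E] [NormedSpace ℝ E] [FiniteDimensional ℝ E]
  [NormedAddCommGroup F] [NormedSpace ℝ F] [FiniteDimensional ℝ F]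

/-- The inverse function theorem in finite dimension. -/
theorem exists_local_inverse (hEF : Module.finrank ℝ E = Module.finrank ℝ F) {f : E → F} {a : E}
    (hf : ∀ᶠ x in 𝓝 a, ContDiffAt ℝ ∞ f x) (hinj : Function.Injective (fderiv ℝ f a)) :
    ∃ K : F → E, (∀ᶠ y in 𝓝 (f a), ContDiffAt ℝ ∞ K y) ∧ K (f a) = a ∧
      (∀ᶠ x in 𝓝 a, K (f x) = x) ∧ ∀ᶠ y in 𝓝 (f a), f (K y) = y := by
  have : CompleteSpace E := FiniteDimensional.complete ℝ E
  have hfa := hf.self_of_nhds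
  let L : E ≃L[ℝ] F := (LinearEquiv.ofInjectiveOfFinrankEq (fderiv ℝ f a : E →ₗ[ℝ] F) hinj
    hEF).toContinuousLinearEquiv
  have h1 : (L : E →L[ℝ] F) = fderiv ℝ f a := by
    ext v
    rfl
  have hL : HasFDerivAt f (L : E →L[ℝ] F) a := by
    rw [h1]
    exact (hfa.differentiableAt (by simp)).hasFDerivAt
  have hs : HasStrictFDerivAt f (L : E →L[ℝ] F) a := hfa.hasStrictFDerivAt' hL (by simp)
  let e := hs.toOpenPartialHomeomorph f
  have hcont : ContinuousAt (hs.localInverse f L a) (f a) := hs.localInverse_continuousAt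
  -- Invertibility is an open condition, so the inverse is smooth on a neighbourhood and not only at
  -- `f a`.
  have hmem : ∀ᶠ x in 𝓝 a, fderiv ℝ f x ∈ range ((↑) : (E ≃L[ℝ] F) → E →L[ℝ] F) := by
    have hc : ContinuousAt (fderiv ℝ f) a :=
      (hfa.fderiv_right (m := 0) (WithTop.coe_le_coe.2 le_top)).continuousAt
    refine hc.eventually ?_
    rw [← h1]
    exact ContinuousLinearEquiv.nhds L
  refine ⟨hs.localInverse f L a, ?_, hs.localInverse_apply_image,
    hs.eventually_left_inverse, hs.eventually_right_inverse⟩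
  have hev := hf.and hmem
  rw [← hs.localInverse_apply_image] at hev
  filter_upwards [hcont.eventually hev,
    e.open_target.mem_nhds hs.image_mem_toOpenPartialHomeomorph_target] with y ⟨hy, L', hL'⟩ hyt
  refine e.contDiffAt_symm (f₀' := L') hyt ?_ hy
  rw [hL']
  exact (hy.differentiableAt (by simp)).hasFDerivAt

/-- An immersion has a smooth local left inverse. -/
theorem exists_local_leftInverse {f : E → F} {a : E}
    (hf : ∀ᶠ x in 𝓝 a, ContDiffAt ℝ ∞ f x) (hinj : Function.Injective (fderiv ℝ f a)) :
    ∃ K : F → E, (∀ᶠ y in 𝓝 (f a), ContDiffAt ℝ ∞ K y) ∧ ∀ᶠ x in 𝓝 a, K (f x) = x := by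
  obtain ⟨L₀, hL₀⟩ := (fderiv ℝ f a : E →ₗ[ℝ] F).exists_leftInverse_of_injective
    (LinearMap.ker_eq_bot.2 hinj)
  let L : F →L[ℝ] E := L₀.toContinuousLinearMap
  have hLf : ∀ᶠ x in 𝓝 a, ContDiffAt ℝ ∞ (L ∘ f) x := by
    filter_upwards [hf] with x hx using L.contDiff.contDiffAt.comp x hx
  have hfd : fderiv ℝ (L ∘ f) a = ContinuousLinearMap.id ℝ E := by
    rw [fderiv_comp _ L.differentiableAt (hf.self_of_nhds.differentiableAt (by simp)), L.fderiv]
    ext v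
    exact congrArg (fun A : E →ₗ[ℝ] E => A v) hL₀
  obtain ⟨K, hK, -, hKL, -⟩ := exists_local_inverse rfl hLf (by
    rw [hfd]
    exact Function.injective_id)
  refine ⟨K ∘ L, ?_, hKL⟩
  filter_upwards [L.continuous.continuousAt.eventually hK] with y hy
  exact hy.comp y L.contDiff.contDiffAt

omit [FiniteDimensional ℝ F] in
/-- A map on a convex set with injective derivative at a point is injective near that point. -/
theorem eventually_injOn_of_injective_fderivWithin {s : Set E} (hs : Convex ℝ s)
    (hu : UniqueDiffOn ℝ s) {f : E → F} {a : E} (ha : a ∈ s) (hf : ContDiffWithinAt ℝ ∞ f s a)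
    (hinj : Function.Injective (fderivWithin ℝ f s a)) :
    ∃ r > 0, InjOn f (Metric.ball a r ∩ s) ∧ ∀ x ∈ Metric.ball a r ∩ s,
      DifferentiableWithinAt ℝ f s x ∧ Function.Injective (fderivWithin ℝ f s x) := by
  set L := fderivWithin ℝ f s a
  obtain ⟨K, hK0, hK⟩ := (L : E →ₗ[ℝ] F).exists_antilipschitzWith (LinearMap.ker_eq_bot.2 hinj)
  have hbound : ∀ v, ‖v‖ ≤ K * ‖L v‖ := fun v => by
    simpa using hK.le_mul_dist v 0
  have hKpos : (0 : ℝ) < K := hK0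
  have hcont : ContinuousWithinAt (fderivWithin ℝ f s) s a :=
    (hf.fderivWithin_right hu (m := 0) (WithTop.coe_le_coe.2 le_top) ha).continuousWithinAt
  have hdiff : ∀ᶠ x in 𝓝[s] a, DifferentiableWithinAt ℝ f s x := by
    have h1 : ContDiffWithinAt ℝ 1 f s a := hf.of_le (WithTop.coe_le_coe.2 le_top)
    have := h1.eventually fun h => ENat.one_ne_top (WithTop.coe_injective h)
    rw [insert_eq_of_mem ha] at this
    filter_upwards [this] with x hx using hx.differentiableWithinAt one_ne_zero
  -- A perturbation of `L` smaller than half of its lower bound `1/K` keeps it injective. With the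
  -- mean value inequality on the convex set this also gives injectivity of `f`, and it works up to
  -- the boundary of a half-space.
  have hclose : ∀ᶠ x in 𝓝[s] a, ‖fderivWithin ℝ f s x - L‖ < (2 * (K : ℝ))⁻¹ := by
    have := hcont.eventually (Metric.ball_mem_nhds L (inv_pos.2 (mul_pos two_pos hKpos)))
    filter_upwards [this] with x hx using by simpa [dist_eq_norm] using hx
  obtain ⟨r, hr, hball⟩ := Metric.mem_nhdsWithin_iff.1 (hdiff.and hclose)
  refine ⟨r, hr, ?_, fun x hx => ⟨(hball hx).1, ?_⟩⟩
  · intro x hx y hy hxy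
    have hmv := ((convex_ball a r).inter hs).norm_image_sub_le_of_norm_hasFDerivWithin_le'
      (f := f) (f' := fderivWithin ℝ f s) (φ := L) (C := (2 * (K : ℝ))⁻¹)
      (fun z hz => (hball hz).1.hasFDerivWithinAt.mono inter_subset_right)
      (fun z hz => (hball hz).2.le) hx hy
    rw [hxy, sub_self, zero_sub, norm_neg] at hmv
    have h1 := hbound (y - x)
    have h2 : (K : ℝ) * ‖L (y - x)‖ ≤ K * ((2 * (K : ℝ))⁻¹ * ‖y - x‖) := by gcongr
    have h3 : (K : ℝ) * ((2 * (K : ℝ))⁻¹ * ‖y - x‖) = ‖y - x‖ / 2 := by field_simp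
    have h4 : ‖y - x‖ = 0 := by linarith [norm_nonneg (y - x)]
    exact (sub_eq_zero.1 (norm_eq_zero.1 h4)).symm
  · refine (injective_iff_map_eq_zero _).2 fun v hv => ?_
    have h1 := hbound v
    have h5 : ‖L v‖ ≤ (2 * (K : ℝ))⁻¹ * ‖v‖ := by
      have h6 : L v = -((fderivWithin ℝ f s x - L) v) := by simp [hv]
      rw [h6, norm_neg]
      exact ((fderivWithin ℝ f s x - L).le_opNorm v).trans
        (mul_le_mul_of_nonneg_right (hball hx).2.le (norm_nonneg v))
    have h2 : (K : ℝ) * ‖L v‖ ≤ K * ((2 * (K : ℝ))⁻¹ * ‖v‖) := by gcongr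
    have h3 : (K : ℝ) * ((2 * (K : ℝ))⁻¹ * ‖v‖) = ‖v‖ / 2 := by field_simp
    have h4 : ‖v‖ = 0 := by linarith [norm_nonneg v]
    exact norm_eq_zero.1 h4

end InverseFunction
-- Embedded spheres and the boundary
section Sphere
open Set Filter Topology

variable {M : Type*} [TopologicalSpace M] [ChartedSpace (EuclideanHalfSpace 3) M]
  [IsManifold (𝓡∂ 3) ∞ M] {ι : S2 → M}

theorem contMDiff_coe_S2 : ContMDiff (𝓡 2) 𝓘(ℝ, E3) ∞ ((↑) : S2 → E3) :=
  have := Fact.mk (finrank_euclideanSpace_fin (𝕜 := ℝ) (n := 2 + 1))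
  contMDiff_coe_sphere

theorem injective_mfderiv_coe_S2 (z : S2) :
    Function.Injective (mfderiv (𝓡 2) 𝓘(ℝ, E3) ((↑) : S2 → E3) z) :=
  have := Fact.mk (finrank_euclideanSpace_fin (𝕜 := ℝ) (n := 2 + 1))
  injective_mvfderiv_subtypeVal_sphere z

/-- A map from the sphere, read in the preferred charts. -/
noncomputable def sphereChart (ι : S2 → M) (z : S2) : EuclideanSpace ℝ (Fin 2) → E3 :=
  extChartAt (𝓡∂ 3) (ι z) ∘ ι ∘ (extChartAt (𝓡 2) z).symm

omit [ChartedSpace (EuclideanHalfSpace 3) M] [IsManifold (𝓡∂ 3) ∞ M] in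
theorem continuousAt_comp_chart_symm (hι : Continuous ι) (z : S2) :
    Tendsto (ι ∘ (extChartAt (𝓡 2) z).symm) (𝓝 (extChartAt (𝓡 2) z z)) (𝓝 (ι z)) := by
  have h := continuousAt_extChartAt_symm (I := 𝓡 2) z
  rw [ContinuousAt, extChartAt_to_inv] at h
  exact (hι.tendsto z).comp h

theorem eventually_contDiffAt_sphereChart (hι : ContMDiff (𝓡 2) (𝓡∂ 3) ∞ ι) (z : S2) :
    ∀ᶠ v in 𝓝 (extChartAt (𝓡 2) z z), ContDiffAt ℝ ∞ (sphereChart ι z) v := by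
  filter_upwards [(isOpen_extChartAt_target (I := 𝓡 2) z).mem_nhds (mem_extChartAt_target z),
    (continuousAt_comp_chart_symm hι.continuous z).eventually
      (extChartAt_source_mem_nhds (I := 𝓡∂ 3) (ι z))] with v hv hs
  have h1 : ContMDiffAt 𝓘(ℝ, EuclideanSpace ℝ (Fin 2)) (𝓡 2) ∞ (extChartAt (𝓡 2) z).symm v :=
    (contMDiffOn_extChartAt_symm z).contMDiffAt
      ((isOpen_extChartAt_target (I := 𝓡 2) z).mem_nhds hv)
  have h2 := hι.contMDiffAt.comp v h1
  rw [extChartAt_source] at hs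
  exact ((contMDiffAt_extChartAt' (I := 𝓡∂ 3) (n := ∞) hs).comp v h2).contDiffAt

theorem injective_fderiv_sphereChart (hι : ContMDiff (𝓡 2) (𝓡∂ 3) ∞ ι) (z : S2)
    (hinj : Function.Injective (mfderiv (𝓡 2) (𝓡∂ 3) ι z)) :
    Function.Injective (fderiv ℝ (sphereChart ι z) (extChartAt (𝓡 2) z z)) := by
  have : IsManifold (𝓡∂ 3) 1 M := IsManifold.of_le (n := ∞) (by simp)
  set s := (extChartAt (𝓡 2) z).symm
  set a := extChartAt (𝓡 2) z z
  have hsa : s a = z := extChartAt_to_inv z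
  have h1 : MDifferentiableAt 𝓘(ℝ, EuclideanSpace ℝ (Fin 2)) (𝓡 2) s a :=
    ((contMDiffOn_extChartAt_symm (n := ∞) z).contMDiffAt
      ((isOpen_extChartAt_target (I := 𝓡 2) z).mem_nhds
        (mem_extChartAt_target z))).mdifferentiableAt (by simp)
  have h2 : MDifferentiableAt (𝓡 2) (𝓡∂ 3) ι (s a) := hι.mdifferentiableAt (by simp)
  have h3 : MDifferentiableAt (𝓡∂ 3) 𝓘(ℝ, E3) (extChartAt (𝓡∂ 3) (ι z)) (ι (s a)) :=
    mdifferentiableAt_extChartAt (by rw [hsa]; exact mem_chart_source _ _)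
  have hs1 : Function.Injective (mfderiv 𝓘(ℝ, EuclideanSpace ℝ (Fin 2)) (𝓡 2) s a) := by
    have h := isInvertible_mfderivWithin_extChartAt_symm (I := 𝓡 2)
      (mem_extChartAt_target (I := 𝓡 2) z)
    rw [ModelWithCorners.range_eq_univ, mfderivWithin_univ] at h
    exact h.injective
  have he : Function.Injective (mfderiv (𝓡∂ 3) 𝓘(ℝ, E3) (extChartAt (𝓡∂ 3) (ι z)) (ι (s a))) :=
    (isInvertible_mfderiv_extChartAt (I := 𝓡∂ 3) (x := ι z)
      (by rw [hsa]; exact mem_extChartAt_source _)).injective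
  have hinj' : Function.Injective (mfderiv (𝓡 2) (𝓡∂ 3) ι (s a)) := by
    rw [hsa]
    exact hinj
  have hc : mfderiv 𝓘(ℝ, EuclideanSpace ℝ (Fin 2)) 𝓘(ℝ, E3) (sphereChart ι z) a =
      (mfderiv (𝓡∂ 3) 𝓘(ℝ, E3) (extChartAt (𝓡∂ 3) (ι z)) (ι (s a))).comp
        ((mfderiv (𝓡 2) (𝓡∂ 3) ι (s a)).comp
          (mfderiv 𝓘(ℝ, EuclideanSpace ℝ (Fin 2)) (𝓡 2) s a)) :=
    (mfderiv_comp a h3 (h2.comp a h1)).trans (by rw [mfderiv_comp a h2 h1]; rfl)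
  rw [← mfderiv_eq_fderiv, hc]
  exact (he.comp hinj').comp hs1

/-- The inclusion of the sphere in space extends locally from an embedded sphere in `M`. -/
theorem exists_local_retraction (hι : ContMDiff (𝓡 2) (𝓡∂ 3) ∞ ι) (hemb : IsEmbedding ι) (z : S2)
    (hinj : Function.Injective (mfderiv (𝓡 2) (𝓡∂ 3) ι z)) :
    ∃ U ∈ 𝓝 (ι z), ∃ r : M → E3, ContMDiffOn (𝓡∂ 3) 𝓘(ℝ, E3) ∞ r U ∧
      ∀ w, ι w ∈ U → r (ι w) = w := by
  obtain ⟨K, hK, hKl⟩ := exists_local_leftInverse (eventually_contDiffAt_sphereChart hι z)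
    (injective_fderiv_sphereChart hι z hinj)
  have hza : sphereChart ι z (extChartAt (𝓡 2) z z) = extChartAt (𝓡∂ 3) (ι z) (ι z) := by
    simp [sphereChart]
  have hKa := hKl.self_of_nhds
  rw [hza] at hK hKa
  have hcont : ContinuousAt (extChartAt (𝓡∂ 3) (ι z)) (ι z) := continuousAt_extChartAt _
  have hKt : ∀ᶠ x in 𝓝 (extChartAt (𝓡∂ 3) (ι z) (ι z)), K x ∈ (extChartAt (𝓡 2) z).target :=
    hK.self_of_nhds.continuousAt.eventually (by
      rw [hKa]
      exact extChartAt_target_mem_nhds z)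
  have hw : ∀ᶠ w in 𝓝 z, w ∈ (extChartAt (𝓡 2) z).source ∧
      K (sphereChart ι z (extChartAt (𝓡 2) z w)) = extChartAt (𝓡 2) z w :=
    inter_mem (extChartAt_source_mem_nhds (I := 𝓡 2) z)
      ((continuousAt_extChartAt (I := 𝓡 2) z).eventually hKl)
  -- The embedding property: points of the sphere whose images are near `ι z` are themselves near
  -- `z`, so the local formula applies to all of them.
  rw [hemb.isInducing.nhds_eq_comap] at hw
  obtain ⟨V, hV, hVw⟩ := hw
  refine ⟨_, inter_mem (extChartAt_source_mem_nhds (I := 𝓡∂ 3) (ι z))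
    (inter_mem (hcont.eventually (hK.and hKt)) hV),
    fun x => ((extChartAt (𝓡 2) z).symm (K (extChartAt (𝓡∂ 3) (ι z) x)) : E3), ?_, ?_⟩
  · rintro x ⟨hx, ⟨hKx, hKtx⟩, -⟩
    rw [extChartAt_source] at hx
    have h1 : ContMDiffAt 𝓘(ℝ, EuclideanSpace ℝ (Fin 2)) (𝓡 2) ∞ (extChartAt (𝓡 2) z).symm
        (K (extChartAt (𝓡∂ 3) (ι z) x)) :=
      (contMDiffOn_extChartAt_symm z).contMDiffAt
        ((isOpen_extChartAt_target (I := 𝓡 2) z).mem_nhds hKtx)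
    have h2 := h1.comp x (hKx.contMDiffAt.comp x (contMDiffAt_extChartAt' (I := 𝓡∂ 3) hx))
    exact (contMDiff_coe_S2.contMDiffAt.comp x h2).contMDiffWithinAt
  · rintro w ⟨-, -, hwV⟩
    obtain ⟨hw1, hw2⟩ := hVw hwV
    have h3 : sphereChart ι z (extChartAt (𝓡 2) z w) = extChartAt (𝓡∂ 3) (ι z) (ι w) := by
      simp only [sphereChart, Function.comp_apply]
      rw [(extChartAt (𝓡 2) z).left_inv hw1]
    rw [h3] at hw2
    simp only [hw2]
    rw [(extChartAt (𝓡 2) z).left_inv hw1]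

/-- The inclusion of the sphere in space extends from an embedded sphere in `M` to `M`. -/
theorem exists_retraction [T2Space M] [SecondCountableTopology M]
    (hι : ContMDiff (𝓡 2) (𝓡∂ 3) ∞ ι) (hemb : IsEmbedding ι)
    (hinj : ∀ z, Function.Injective (mfderiv (𝓡 2) (𝓡∂ 3) ι z)) :
    ∃ r : M → E3, ContMDiff (𝓡∂ 3) 𝓘(ℝ, E3) ∞ r ∧ ∀ w, r (ι w) = w := by
  have : LocallyCompactSpace M := Manifold.locallyCompact_of_finiteDimensional (𝓡∂ 3)
  have hcl : IsClosed (range ι) := (isCompact_range hemb.continuous).isClosed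
  -- A partition of unity glues the local extensions, as prescribing the value on the sphere is a
  -- convex condition.
  obtain ⟨r, hr⟩ := exists_contMDiffMap_forall_mem_convex_of_local (𝓡∂ 3) (n := ⊤)
    (t := fun x => {y : E3 | ∀ w, ι w = x → y = w}) (fun x y hy y' hy' a b _ _ hab w hw => by
      rw [hy w hw, hy' w hw, ← add_smul, hab, one_smul]) (fun x => by
      by_cases hx : x ∈ range ι
      · obtain ⟨z, rfl⟩ := hx
        obtain ⟨U, hU, r, hr, hrU⟩ := exists_local_retraction hι hemb z (hinj z)
        exact ⟨U, hU, r, hr, fun y hy w hw => by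
          rw [← hw] at hy ⊢
          exact hrU w hy⟩
      · exact ⟨(range ι)ᶜ, hcl.isOpen_compl.mem_nhds hx, fun _ => 0, contMDiffOn_const,
          fun y hy w hw => (hy ⟨w, hw⟩).elim⟩)
  exact ⟨r, r.contMDiff, fun w => hr (ι w) w rfl⟩

/-- Being an interior point can be tested in any chart around the point. -/
theorem mem_boundary_iff {p x : M} (hx : x ∈ (extChartAt (𝓡∂ 3) p).source) :
    x ∈ (𝓡∂ 3).boundary M ↔ extChartAt (𝓡∂ 3) p x 0 = 0 := by
  have h0 : 0 ≤ extChartAt (𝓡∂ 3) p x 0 := by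
    have : extChartAt (𝓡∂ 3) p x ∈ range (𝓡∂ 3) :=
      extChartAt_target_subset_range p ((extChartAt (𝓡∂ 3) p).map_source hx)
    rwa [range_modelWithCornersEuclideanHalfSpace] at this
  have hi : (𝓡∂ 3).IsInteriorPoint x ↔
      extChartAt (𝓡∂ 3) p x ∈ interior (extChartAt (𝓡∂ 3) p).target :=
    ModelWithCorners.isInteriorPoint_iff_of_mem_atlas (n := ∞) (by simp)
      (chart_mem_atlas (EuclideanHalfSpace 3) p) (by rwa [extChartAt_source] at hx)
  rw [← ModelWithCorners.compl_interior, mem_compl_iff]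
  change ¬ (𝓡∂ 3).IsInteriorPoint x ↔ _
  rw [hi, ← not_iff_not, not_not]
  constructor
  · intro h
    have h1 := interior_mono (extChartAt_target_subset_range p) h
    rw [interior_range_modelWithCornersEuclideanHalfSpace] at h1
    exact ne_of_gt h1
  · intro h
    have h1 : extChartAt (𝓡∂ 3) p x ∈ interior (range (𝓡∂ 3)) := by
      rw [interior_range_modelWithCornersEuclideanHalfSpace]
      exact lt_of_le_of_ne h0 (Ne.symm h)
    rw [mem_interior_iff_mem_nhds] at h1 ⊢
    have h2 := extChartAt_target_mem_nhdsWithin_of_mem (I := 𝓡∂ 3)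
      ((extChartAt (𝓡∂ 3) p).map_source hx)
    rwa [nhdsWithin_eq_nhds.2 h1] at h2

/-- A sphere contained in the boundary is a neighbourhood of its points in the boundary. -/
theorem eventually_mem_range_of_mem_boundary (hι : ContMDiff (𝓡 2) (𝓡∂ 3) ∞ ι) (z : S2)
    (hinj : Function.Injective (mfderiv (𝓡 2) (𝓡∂ 3) ι z))
    (hb : range ι ⊆ (𝓡∂ 3).boundary M) :
    ∀ᶠ x in 𝓝 (ι z), x ∈ (𝓡∂ 3).boundary M → x ∈ range ι := by
  set a := extChartAt (𝓡 2) z z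
  -- The sphere lies in the boundary plane, where the zeroth coordinate vanishes. The other two
  -- coordinates thus give a local diffeomorphism from the sphere to that plane.
  let τ : E3 →L[ℝ] ℝ × ℝ := (EuclideanSpace.proj 1 : E3 →L[ℝ] ℝ).prod (EuclideanSpace.proj 2)
  have hsm := eventually_contDiffAt_sphereChart hι z
  have h0 : ∀ᶠ v in 𝓝 a, ι ((extChartAt (𝓡 2) z).symm v) ∈ (extChartAt (𝓡∂ 3) (ι z)).source ∧
      sphereChart ι z v 0 = 0 := by
    filter_upwards [(continuousAt_comp_chart_symm hι.continuous z).eventually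
      (extChartAt_source_mem_nhds (I := 𝓡∂ 3) (ι z))] with v hv
    exact ⟨hv, (mem_boundary_iff hv).1 (hb (mem_range_self _))⟩
  have hd : DifferentiableAt ℝ (sphereChart ι z) a := hsm.self_of_nhds.differentiableAt (by simp)
  have hd0 : ∀ v, fderiv ℝ (sphereChart ι z) a v 0 = 0 := fun v => by
    have h1 : (fun v => (EuclideanSpace.proj 0 : E3 →L[ℝ] ℝ) (sphereChart ι z v)) =ᶠ[𝓝 a]
        fun _ => 0 := h0.mono fun v hv => hv.2
    have h2 := (((EuclideanSpace.proj 0 : E3 →L[ℝ] ℝ).hasFDerivAt.comp a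
      hd.hasFDerivAt).congr_of_eventuallyEq h1.symm).unique (hasFDerivAt_const 0 a)
    exact congrArg (fun A : EuclideanSpace ℝ (Fin 2) →L[ℝ] ℝ => A v) h2
  obtain ⟨K, hK, hKa, -, hKr⟩ := exists_local_inverse (F := ℝ × ℝ) (by simp)
    (f := τ ∘ sphereChart ι z) (a := a)
    (hsm.mono fun v hv => τ.contDiff.contDiffAt.comp v hv) (by
      rw [fderiv_comp _ τ.differentiableAt hd, τ.fderiv]
      refine (injective_iff_map_eq_zero _).2 fun v hv => ?_
      refine (injective_iff_map_eq_zero _).1 (injective_fderiv_sphereChart hι z hinj) v ?_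
      have h1 : fderiv ℝ (sphereChart ι z) a v 1 = 0 := congrArg Prod.fst hv
      have h2 : fderiv ℝ (sphereChart ι z) a v 2 = 0 := congrArg Prod.snd hv
      ext i
      fin_cases i
      exacts [hd0 v, h1, h2])
  have hza : (τ ∘ sphereChart ι z) a = τ (extChartAt (𝓡∂ 3) (ι z) (ι z)) := by
    simp [sphereChart, a]
  rw [hza] at hK hKa hKr
  have hcont : ContinuousAt (τ ∘ extChartAt (𝓡∂ 3) (ι z)) (ι z) :=
    τ.continuous.continuousAt.comp (continuousAt_extChartAt _)
  rw [← hKa] at h0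
  filter_upwards [extChartAt_source_mem_nhds (I := 𝓡∂ 3) (ι z), hcont.eventually hKr,
    hcont.eventually (hK.self_of_nhds.continuousAt.eventually h0)] with x hx hKx ⟨hs, h0x⟩ hxb
  refine ⟨_, (extChartAt (𝓡∂ 3) (ι z)).injOn hs hx (?_ : sphereChart ι z _ = _)⟩
  have hx0 := (mem_boundary_iff hx).1 hxb
  ext i
  fin_cases i
  exacts [h0x.trans hx0.symm, congrArg Prod.fst hKx, congrArg Prod.snd hKx]

end Sphere
-- Construction of the collar
section Collar
open Set Filter Topology

variable {M : Type*} [TopologicalSpace M] [ChartedSpace (EuclideanHalfSpace 3) M]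
  [IsManifold (𝓡∂ 3) ∞ M] {ι : S2 → M} {ρ : M → ℝ} {c : ℝ}

/-- `Θ` is a smooth local inverse, near `q`, of the differentiable map `G`. -/
structure IsLocalInverse (G : M → E3) (q : M) (Θ : E3 → M) : Prop where
  mdifferentiableAt : MDifferentiableAt (𝓡∂ 3) 𝓘(ℝ, E3) G q
  contMDiffAt : ContMDiffAt 𝓘(ℝ, E3) (𝓡∂ 3) ∞ Θ (G q)
  left_inv : ∀ᶠ x in 𝓝 q, Θ (G x) = x
  right_inv : ∀ᶠ y in 𝓝 (G q), G (Θ y) = y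

/-- Away from the boundary the half-space is a neighbourhood of the chart image, and the ordinary
inverse function theorem applies. -/
theorem exists_isLocalInverse {G : M → E3} {p q : M}
    (hq : q ∈ (extChartAt (𝓡∂ 3) p).source) (hqb : q ∉ (𝓡∂ 3).boundary M)
    (hG : ∀ᶠ x in 𝓝 q, ContMDiffAt (𝓡∂ 3) 𝓘(ℝ, E3) ∞ G x)
    (hinj : Function.Injective (fderivWithin ℝ (G ∘ (extChartAt (𝓡∂ 3) p).symm) (range (𝓡∂ 3))
      (extChartAt (𝓡∂ 3) p q))) :
    ∃ Θ, IsLocalInverse G q Θ := by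
  set e := extChartAt (𝓡∂ 3) p
  have hrange : range (𝓡∂ 3) ∈ 𝓝 (e q) := by
    have h0 : e q ∈ range (𝓡∂ 3) := extChartAt_target_subset_range p (e.map_source hq)
    rw [range_modelWithCornersEuclideanHalfSpace] at h0
    rw [← mem_interior_iff_mem_nhds, interior_range_modelWithCornersEuclideanHalfSpace]
    exact lt_of_le_of_ne h0 fun h => hqb ((mem_boundary_iff hq).2 h.symm)
  have htarget : e.target ∈ 𝓝 (e q) := by
    have h := extChartAt_target_mem_nhdsWithin_of_mem (I := 𝓡∂ 3) (e.map_source hq)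
    rwa [nhdsWithin_eq_nhds.2 hrange] at h
  have hsymm : ∀ᶠ y in 𝓝 (e q), ContMDiffAt 𝓘(ℝ, E3) (𝓡∂ 3) ∞ e.symm y :=
    (eventually_mem_nhds_iff.2 htarget).mono fun y hy =>
      (contMDiffOn_extChartAt_symm p).contMDiffAt hy
  have heq : e.symm (e q) = q := e.left_inv hq
  have hGe : ∀ᶠ y in 𝓝 (e q), ContMDiffAt (𝓡∂ 3) 𝓘(ℝ, E3) ∞ G (e.symm y) := by
    refine hsymm.self_of_nhds.continuousAt.eventually ?_
    rwa [heq]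
  rw [fderivWithin_of_mem_nhds hrange] at hinj
  obtain ⟨K, hK, hKq, hKl, hKr⟩ := exists_local_inverse rfl
    ((hsymm.and hGe).mono fun y hy => (hy.2.comp y hy.1).contDiffAt) hinj
  have hGq : (G ∘ e.symm) (e q) = G q := congrArg G heq
  rw [hGq] at hK hKq hKr
  have hes : ContinuousAt e q := continuousAt_extChartAt' hq
  refine ⟨e.symm ∘ K, hG.self_of_nhds.mdifferentiableAt (by simp), ?_, ?_, hKr⟩
  · refine ContMDiffAt.comp (G q) ?_ hK.self_of_nhds.contMDiffAt
    rw [hKq]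
    exact hsymm.self_of_nhds
  · filter_upwards [hes.eventually hKl, extChartAt_source_mem_nhds' hq] with x hx hxs
    simp only [Function.comp_apply] at hx ⊢
    rw [e.left_inv hxs] at hx
    rw [hx, e.left_inv hxs]

/-- A map with injective differential at `p` is injective near `p`, and it is a local
diffeomorphism at the interior points near `p`. -/
theorem exists_injOn_nhds {G : M → E3} {p : M}
    (hG : ∀ᶠ x in 𝓝 p, ContMDiffAt (𝓡∂ 3) 𝓘(ℝ, E3) ∞ G x)
    (hinj : Function.Injective (mfderiv (𝓡∂ 3) 𝓘(ℝ, E3) G p)) :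
    ∃ W ∈ 𝓝 p, InjOn G W ∧
      ∀ q ∈ W, q ∉ (𝓡∂ 3).boundary M → ∃ Θ, IsLocalInverse G q Θ := by
  have : IsManifold (𝓡∂ 3) 1 M := IsManifold.of_le (n := ∞) (by simp)
  set e := extChartAt (𝓡∂ 3) p
  have hep : e.symm (e p) = p := extChartAt_to_inv p
  have h1 : ContMDiffWithinAt 𝓘(ℝ, E3) (𝓡∂ 3) ∞ e.symm (range (𝓡∂ 3)) (e p) :=
    contMDiffWithinAt_extChartAt_symm_range_self p
  have hG' : ContMDiffAt (𝓡∂ 3) 𝓘(ℝ, E3) ∞ G (e.symm (e p)) := by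
    rw [hep]
    exact hG.self_of_nhds
  have hf : ContDiffWithinAt ℝ ∞ (G ∘ e.symm) (range (𝓡∂ 3)) (e p) :=
    (hG'.comp_contMDiffWithinAt (e p) h1).contDiffWithinAt
  have hmem : e p ∈ range (𝓡∂ 3) := mem_range_self _
  have hfd : Function.Injective (fderivWithin ℝ (G ∘ e.symm) (range (𝓡∂ 3)) (e p)) := by
    have hc : mfderivWithin 𝓘(ℝ, E3) 𝓘(ℝ, E3) (G ∘ e.symm) (range (𝓡∂ 3)) (e p) =
        (mfderiv (𝓡∂ 3) 𝓘(ℝ, E3) G (e.symm (e p))).comp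
          (mfderivWithin 𝓘(ℝ, E3) (𝓡∂ 3) e.symm (range (𝓡∂ 3)) (e p)) :=
      mfderiv_comp_mfderivWithin (e p) (hG'.mdifferentiableAt (by simp))
        (h1.mdifferentiableWithinAt (by simp))
        ((𝓡∂ 3).uniqueMDiffOn _ hmem)
    have hi := (isInvertible_mfderivWithin_extChartAt_symm (I := 𝓡∂ 3)
      (mem_extChartAt_target (I := 𝓡∂ 3) p)).injective
    have hinj' : Function.Injective (mfderiv (𝓡∂ 3) 𝓘(ℝ, E3) G (e.symm (e p))) := by
      rw [hep]
      exact hinj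
    rw [← mfderivWithin_eq_fderivWithin, hc]
    exact hinj'.comp hi
  obtain ⟨r, hr, hinjOn, hball⟩ := eventually_injOn_of_injective_fderivWithin
    (𝓡∂ 3).convex_range (𝓡∂ 3).uniqueDiffOn hmem hf hfd
  have hU : ∀ᶠ x in 𝓝 p, x ∈ e.source ∧ e x ∈ Metric.ball (e p) r ∧
      ∀ᶠ x in 𝓝 x, ContMDiffAt (𝓡∂ 3) 𝓘(ℝ, E3) ∞ G x :=
    inter_mem (extChartAt_source_mem_nhds p) (inter_mem
      ((continuousAt_extChartAt p).eventually (Metric.ball_mem_nhds _ hr)) hG.eventually_nhds)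
  have hsub : ∀ x ∈ e.source, e x ∈ range (𝓡∂ 3) := fun x hx =>
    extChartAt_target_subset_range p (e.map_source hx)
  refine ⟨_, hU, ?_, ?_⟩
  · rintro x ⟨hx, hxr, -⟩ y ⟨hy, hyr, -⟩ hxy
    refine e.injOn hx hy (hinjOn ⟨hxr, hsub x hx⟩ ⟨hyr, hsub y hy⟩ ?_)
    simp only [Function.comp_apply]
    rw [e.left_inv hx, e.left_inv hy, hxy]
  · rintro q ⟨hq, hqr, hGq⟩ hqb
    exact exists_isLocalInverse hq hqb hGq (hball _ ⟨hqr, hsub q hq⟩).2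

/-- A plane in space is the range of any injective map of a plane into it. -/
theorem exists_eq_of_mem_ker {E F : Type*} [AddCommGroup E] [Module ℝ E] [FiniteDimensional ℝ E]
    [AddCommGroup F] [Module ℝ F] [FiniteDimensional ℝ F]
    (hEF : Module.finrank ℝ F = Module.finrank ℝ E + 1) {A : E →ₗ[ℝ] F}
    (hA : Function.Injective A) {r : F →ₗ[ℝ] ℝ} (hr : r ≠ 0) (hrA : ∀ w, r (A w) = 0) {v : F}
    (hv : r v = 0) : ∃ w, A w = v := by
  have h1 : LinearMap.range A ≤ LinearMap.ker r := by
    rintro _ ⟨w, rfl⟩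
    exact hrA w
  have h2 : Module.finrank ℝ (LinearMap.range A) = Module.finrank ℝ (LinearMap.ker r) := by
    have h3 := Module.Dual.finrank_ker_add_one_of_ne_zero (f := r) hr
    rw [LinearMap.finrank_range_of_inj hA]
    omega
  have h4 : v ∈ LinearMap.range A := by
    rw [Submodule.eq_of_le_of_finrank_eq h1 h2]
    exact hv
  exact h4

-- If `dG(v) = 0`, then `dρ(v) = 0` because `ρ` is a function of `‖G‖`. So `v` is tangent to the
-- sphere, where `G` is the inclusion into space and hence an immersion.
omit [IsManifold (𝓡∂ 3) ∞ M] in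
theorem injective_mfderiv_of_norm_eq {G : M → E3} (hι : ContMDiff (𝓡 2) (𝓡∂ 3) ∞ ι) {z : S2}
    (hinj : Function.Injective (mfderiv (𝓡 2) (𝓡∂ 3) ι z))
    (hρ : ContMDiff (𝓡∂ 3) 𝓘(ℝ, ℝ) ∞ ρ) (hρι : ∀ w, ρ (ι w) = c)
    (hdρ : (mfderiv (𝓡∂ 3) 𝓘(ℝ, ℝ) ρ (ι z) : T (ι z) →L[ℝ] ℝ) ≠ 0)
    (hG : ContMDiffAt (𝓡∂ 3) 𝓘(ℝ, E3) ∞ G (ι z)) (hGι : ∀ w, G (ι w) = w)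
    (hnorm : ∀ᶠ x in 𝓝 (ι z), ‖G x‖ = 1 + (ρ x - c)) :
    Function.Injective (mfderiv (𝓡∂ 3) 𝓘(ℝ, E3) G (ι z)) := by
  have hGd : MDifferentiableAt (𝓡∂ 3) 𝓘(ℝ, E3) G (ι z) := hG.mdifferentiableAt (by simp)
  have hιd : MDifferentiableAt (𝓡 2) (𝓡∂ 3) ι z := hι.mdifferentiableAt (by simp)
  have hρd : MDifferentiableAt (𝓡∂ 3) 𝓘(ℝ, ℝ) ρ (ι z) := hρ.mdifferentiableAt (by simp)
  refine (injective_iff_map_eq_zero _).2 fun v hv => ?_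
  have h1 : differential ρ (ι z) v = 0 := by
    have hN : DifferentiableAt ℝ (fun y : E3 => ‖y‖ - 1 + c) (G (ι z)) := by
      have h0 : G (ι z) ≠ 0 := by
        rw [hGι]
        exact ne_zero_of_mem_unit_sphere z
      exact ((differentiableAt_id.norm ℝ h0).sub_const 1).add_const c
    have h2 : ρ =ᶠ[𝓝 (ι z)] (fun y : E3 => ‖y‖ - 1 + c) ∘ G := by
      filter_upwards [hnorm] with x hx
      simp only [Function.comp_apply, hx]
      ring
    have h3 : mfderiv (𝓡∂ 3) 𝓘(ℝ, ℝ) ρ (ι z) v =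
        mfderiv (𝓡∂ 3) 𝓘(ℝ, ℝ) ((fun y : E3 => ‖y‖ - 1 + c) ∘ G) (ι z) v := by
      rw [h2.mfderiv_eq]
      rfl
    refine h3.trans ((mfderiv_comp_apply (ι z) hN.mdifferentiableAt hGd v).trans ?_)
    exact (congrArg _ hv).trans (map_zero _)
  have h4 : ∀ w, differential ρ (ι z) (mfderiv (𝓡 2) (𝓡∂ 3) ι z w) = 0 := fun w => by
    refine (mfderiv_comp_apply z hρd hιd w).symm.trans ?_
    have h5 : ρ ∘ ι = fun _ => c := funext hρι
    rw [h5, mfderiv_const]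
    rfl
  have hfin : Module.finrank ℝ E3 = Module.finrank ℝ (EuclideanSpace ℝ (Fin 2)) + 1 := by simp
  obtain ⟨w, hw⟩ := exists_eq_of_mem_ker (E := EuclideanSpace ℝ (Fin 2)) (F := E3) hfin
    (A := ContinuousLinearMap.toLinearMap (M := EuclideanSpace ℝ (Fin 2)) (M₂ := E3)
      (mfderiv (𝓡 2) (𝓡∂ 3) ι z)) hinj (r := differential ρ (ι z))
    (fun h => hdρ (ContinuousLinearMap.ext fun v => congrArg (fun A : E3 →ₗ[ℝ] ℝ => A v) h)) h4 h1
  have h6 : mfderiv (𝓡 2) 𝓘(ℝ, E3) ((↑) : S2 → E3) z w = 0 := by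
    have h7 : ((↑) : S2 → E3) = G ∘ ι := funext fun w => (hGι w).symm
    rw [h7]
    refine (mfderiv_comp_apply z hGd hιd w).trans ?_
    exact (congrArg (mfderiv (𝓡∂ 3) 𝓘(ℝ, E3) G (ι z)) hw).trans hv
  have h8 : w = 0 := (injective_iff_map_eq_zero _).1 (injective_mfderiv_coe_S2 z) w h6
  rw [← hw, h8]
  exact map_zero (mfderiv (𝓡 2) (𝓡∂ 3) ι z)

/-- A compact neighbourhood of a sphere `ι`, with a system of polar coordinates `G` for which
the level sets of `ρ` are concentric spheres. -/
structure IsCollar (ι : S2 → M) (ρ : M → ℝ) (c : ℝ) (V : Set M) (G : M → E3) : Prop where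
  isCompact : IsCompact V
  subset_interior : range ι ⊆ interior V
  injOn : InjOn G V
  continuousOn : ContinuousOn G V
  norm_eq : ∀ q ∈ V, ‖G q‖ = 1 + (ρ q - c)
  apply_sphere : ∀ w, G (ι w) = w
  exists_isLocalInverse : ∀ q ∈ V, q ∉ range ι → ∃ Θ, IsLocalInverse G q Θ

theorem exists_isCollar [T2Space M] [SecondCountableTopology M]
    (hι : ContMDiff (𝓡 2) (𝓡∂ 3) ∞ ι) (hemb : IsEmbedding ι)
    (hinj : ∀ z, Function.Injective (mfderiv (𝓡 2) (𝓡∂ 3) ι z))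
    (hρ : ContMDiff (𝓡∂ 3) 𝓘(ℝ, ℝ) ∞ ρ) (hρι : ∀ w, ρ (ι w) = c) (hc : IsRegularValue ρ c)
    (hb : range ι ∩ (𝓡∂ 3).boundary M = ∅ ∨ range ι ⊆ (𝓡∂ 3).boundary M) :
    ∃ V G, IsCollar ι ρ c V G := by
  have : LocallyCompactSpace M := Manifold.locallyCompact_of_finiteDimensional (𝓡∂ 3)
  obtain ⟨R, hR, hRι⟩ := exists_retraction hι hemb hinj
  -- The direction is that of the extended inclusion `R`; the length is prescribed so that `ρ`
  -- becomes the radius up to a constant.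
  let G : M → E3 := fun x => ((1 + (ρ x - c)) * ‖R x‖⁻¹) • R x
  let O : Set M := {x | R x ≠ 0 ∧ |ρ x - c| < 1}
  have hO : IsOpen O := (isOpen_ne_fun hR.continuous continuous_const).inter
    (isOpen_lt (hρ.continuous.sub continuous_const).abs continuous_const)
  have hιO : range ι ⊆ O := by
    rintro _ ⟨w, rfl⟩
    refine ⟨?_, ?_⟩
    · rw [hRι]
      exact ne_zero_of_mem_unit_sphere w
    · simp [hρι]
  have hG : ∀ x ∈ O, ContMDiffAt (𝓡∂ 3) 𝓘(ℝ, E3) ∞ G x := fun x hx => by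
    have h1 : ContMDiffAt (𝓡∂ 3) 𝓘(ℝ, ℝ) ∞ (fun x => 1 + (ρ x - c)) x :=
      contMDiffAt_const.add (hρ.contMDiffAt.sub contMDiffAt_const)
    have h2 : ContMDiffAt (𝓡∂ 3) 𝓘(ℝ, ℝ) ∞ (fun x => ‖R x‖⁻¹) x :=
      ContMDiffAt.comp (g := fun y : E3 => ‖y‖⁻¹) x
        (((contDiffAt_norm ℝ hx.1).inv (norm_ne_zero_iff.2 hx.1)).contMDiffAt) hR.contMDiffAt
    exact (h1.mul h2).smul hR.contMDiffAt
  have hnorm : ∀ x ∈ O, ‖G x‖ = 1 + (ρ x - c) := fun x hx => by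
    have h1 := (abs_lt.1 hx.2).1
    have h2 : 0 ≤ 1 + (ρ x - c) := by linarith
    rw [norm_smul, norm_mul, norm_inv, norm_norm, Real.norm_of_nonneg h2, mul_assoc,
      inv_mul_cancel₀ (norm_ne_zero_iff.2 hx.1), mul_one]
  have hGι : ∀ w, G (ι w) = w := fun w => by
    simp [G, hRι, hρι]
  have hcompact : IsCompact (range ι) := isCompact_range hemb.continuous
  have hloc : ∀ z, ∃ W ∈ 𝓝 (ι z), InjOn G W ∧
      ∀ q ∈ W, q ∉ (𝓡∂ 3).boundary M → ∃ Θ, IsLocalInverse G q Θ := fun z => by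
    have hz : O ∈ 𝓝 (ι z) := hO.mem_nhds (hιO (mem_range_self z))
    exact exists_injOn_nhds (eventually_of_mem hz hG) (injective_mfderiv_of_norm_eq hι (hinj z) hρ
      hρι (hc _ (hρι z)) (hG _ (hιO (mem_range_self z))) hGι (eventually_of_mem hz hnorm))
  -- In both cases the boundary points near the sphere lie on it, so nearby points off the sphere
  -- are interior.
  have hbdry : ∀ z, ∀ᶠ x in 𝓝 (ι z), x ∈ (𝓡∂ 3).boundary M → x ∈ range ι := fun z => by
    rcases hb with hb | hb
    · have h1 : ι z ∈ (𝓡∂ 3).interior M := by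
        rw [← ModelWithCorners.compl_boundary]
        exact fun h => (hb ▸ ⟨mem_range_self z, h⟩ : ι z ∈ (∅ : Set M))
      filter_upwards [(ModelWithCorners.isOpen_interior (I := 𝓡∂ 3) (M := M) (n := ∞)
        (by simp)).mem_nhds h1] with x hx hxb
      rw [← ModelWithCorners.compl_boundary] at hx
      exact (hx hxb).elim
    · exact eventually_mem_range_of_mem_boundary hι z (hinj z) hb
  have hinjOn : InjOn G (range ι) := by
    rintro _ ⟨w, rfl⟩ _ ⟨w', rfl⟩ h
    rw [hGι, hGι] at h
    rw [Subtype.coe_injective h]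
  -- A map injective on a compact set and locally injective around it is injective on a
  -- neighbourhood of it.
  obtain ⟨t, ht, htG⟩ := hinjOn.exists_mem_nhdsSet hcompact
    (by
      rintro x hx
      exact (hG x (hιO hx)).continuousAt)
    (by
      rintro _ ⟨z, rfl⟩
      obtain ⟨W, hW, hWG, -⟩ := hloc z
      exact ⟨W, hW, hWG⟩)
  have hP : {q | q ∉ range ι → ∃ Θ, IsLocalInverse G q Θ} ∈ 𝓝ˢ (range ι) := by
    rw [mem_nhdsSet_iff_forall]
    rintro _ ⟨z, rfl⟩
    obtain ⟨W, hW, -, hWG⟩ := hloc z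
    filter_upwards [hW, hbdry z] with q hq hqb hqι
    exact hWG q hq fun h => hqι (hqb h)
  obtain ⟨U, hU, hιU, hUs⟩ := mem_nhdsSet_iff_exists.1
    (inter_mem (inter_mem ht hP) (hO.mem_nhdsSet.2 hιO))
  obtain ⟨V, hV, hιV, hVU⟩ := exists_compact_between hcompact hU hιU
  exact ⟨V, G, hV, hιV, htG.mono fun x hx => (hUs (hVU hx)).1.1,
    fun x hx => (hG x (hUs (hVU hx)).2).continuousAt.continuousWithinAt,
    fun x hx => hnorm x (hUs (hVU hx)).2, hGι, fun q hq => (hUs (hVU hq)).1.2⟩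

end Collar
-- Nearby level sets are complete spheres
section Shell
open Set Filter Topology

variable {M : Type*} [TopologicalSpace M] [ChartedSpace (EuclideanHalfSpace 3) M]
  {ι : S2 → M} {ρ : M → ℝ} {c : ℝ} {V : Set M} {G : M → E3}

/-- Its image `G q` lies on the unit sphere, which `G` already covers by `S`; injectivity excludes
any further piece of the level set. -/
theorem IsCollar.mem_range_of_eq (h : IsCollar ι ρ c V G) {q : M} (hq : q ∈ V) (hρq : ρ q = c) :
    q ∈ range ι := by
  have h1 : ‖G q‖ = 1 := by
    rw [h.norm_eq q hq, hρq]
    simp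
  refine ⟨⟨G q, mem_sphere_zero_iff_norm.2 h1⟩,
    h.injOn (interior_subset (h.subset_interior (mem_range_self _))) hq ?_⟩
  rw [h.apply_sphere]

theorem IsLocalInverse.tendsto {Θ : E3 → M} {q : M} (h : IsLocalInverse G q Θ) :
    Tendsto Θ (𝓝 (G q)) (𝓝 q) := by
  have h1 := h.contMDiffAt.continuousAt
  rwa [ContinuousAt, h.left_inv.self_of_nhds] at h1

/-- The local inverses of the polar coordinates of a collar fit together. -/
theorem IsCollar.exists_inverse (h : IsCollar ι ρ c V G) :
    ∃ Θ : E3 → M, ∀ q ∈ interior V, q ∉ range ι → IsLocalInverse G q Θ := by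
  classical
  have : Nonempty M := ⟨ι ⟨EuclideanSpace.single 0 1, by simp⟩⟩
  refine ⟨Function.invFunOn G V, fun q hq hqι => ?_⟩
  have hV : V ∈ 𝓝 q := mem_interior_iff_mem_nhds.1 hq
  obtain ⟨Θ, hΘ⟩ := h.exists_isLocalInverse q (interior_subset hq) hqι
  -- Injectivity of `G` on `V` forces the global set-theoretic inverse to agree with each smooth
  -- local one.
  have heq : Function.invFunOn G V =ᶠ[𝓝 (G q)] Θ := by
    filter_upwards [hΘ.tendsto.eventually hV, hΘ.right_inv] with y hy hGy
    have h1 : y ∈ G '' V := ⟨Θ y, hy, hGy⟩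
    exact h.injOn (Function.invFunOn_mem h1) hy ((Function.invFunOn_eq h1).trans hGy.symm)
  refine ⟨hΘ.mdifferentiableAt, hΘ.contMDiffAt.congr_of_eventuallyEq heq, ?_, ?_⟩
  · filter_upwards [hV] with x hx using h.injOn.leftInvOn_invFunOn hx
  · filter_upwards [heq, hΘ.right_inv] with y hy hGy
    rw [hy, hGy]

/-- The points of the collar fill complete spherical shells. -/
theorem IsCollar.exists_eq_smul [T2Space M] (h : IsCollar ι ρ c V G) (hρι : ∀ w, ρ (ι w) = c)
    (hρ : Continuous ρ)
    {δ : ℝ} (hδ1 : δ ≤ 1) (hδ : ∀ q ∈ frontier V, δ ≤ |ρ q - c|) {J : Set ℝ} (hJ : IsPreconnected J)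
    (hJδ : ∀ s ∈ J, s ≠ 0 ∧ |s| < δ) {q : M} (hq : q ∈ V) (hqJ : ρ q - c ∈ J) {s : ℝ} (hs : s ∈ J)
    {z : E3} (hz : ‖z‖ = 1) :
    ∃ x ∈ interior V, x ∉ range ι ∧ G x = (1 + s) • z := by
  let U : Set M := {x | x ∈ interior V ∧ x ∉ range ι}
  have hVc : IsClosed V := h.isCompact.isClosed
  have hmem : ∀ x ∈ V, ρ x - c ∈ J → x ∈ U := fun x hx hxJ => by
    obtain ⟨h0, h1⟩ := hJδ _ hxJ
    refine ⟨?_, ?_⟩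
    · by_contra hxi
      exact absurd (hδ x ⟨subset_closure hx, hxi⟩) (not_le.2 h1)
    · rintro ⟨w, rfl⟩
      exact h0 (by rw [hρι, sub_self])
  have hUo : IsOpen U := by
    have h1 : U = interior V ∩ (ρ ⁻¹' {c})ᶜ := by
      ext x
      refine and_congr_right fun hx => not_congr ⟨?_, ?_⟩
      · rintro ⟨w, rfl⟩
        exact hρι w
      · exact h.mem_range_of_eq (interior_subset hx)
    rw [h1]
    exact isOpen_interior.inter (isClosed_singleton.preimage hρ).isOpen_compl
  -- The connected shell of radii `1 + s`, `s ∈ J`. The image of `U` is open by local invertibility;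
  -- it is closed in the shell because `V` is compact and its frontier stays where `|ρ - c| ≥ δ`.
  let Sh : Set E3 := (fun a : ℝ × E3 => (1 + a.1) • a.2) '' (J ×ˢ Metric.sphere (0 : E3) 1)
  have hSh : IsPreconnected Sh := by
    refine (hJ.prod (isPreconnected_sphere ?_ 0 1)).image _ ?_
    · rw [← Module.finrank_eq_rank, finrank_euclideanSpace_fin]
      norm_num
    · exact ((continuous_const.add continuous_fst).smul continuous_snd).continuousOn
  have hPo : IsOpen (G '' U) := by
    rw [isOpen_iff_mem_nhds]
    rintro _ ⟨x, hx, rfl⟩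
    obtain ⟨Θ, hΘ⟩ := h.exists_isLocalInverse x (interior_subset hx.1) hx.2
    filter_upwards [hΘ.tendsto.eventually (hUo.mem_nhds hx), hΘ.right_inv] with y hy hGy
    exact ⟨Θ y, hy, hGy⟩
  have hnorm : ∀ x ∈ V, ∀ s ∈ J, ∀ z : E3, ‖z‖ = 1 → G x = (1 + s) • z → ρ x - c = s := by
    intro x hx s hs z hz hxz
    have h1 := h.norm_eq x hx
    have h2 : 0 ≤ 1 + s := by linarith [(abs_lt.1 (hJδ s hs).2).1]
    rw [hxz, norm_smul, hz, mul_one, Real.norm_of_nonneg h2] at h1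
    linarith
  have hcl : closure (G '' U) ∩ Sh ⊆ G '' U := by
    rintro _ ⟨hy, ⟨s, z⟩, ⟨hs, hz⟩, rfl⟩
    have h1 : closure (G '' U) ⊆ G '' V :=
      closure_minimal (image_mono fun x hx => interior_subset hx.1)
        (h.isCompact.image_of_continuousOn h.continuousOn).isClosed
    obtain ⟨x, hx, hxy⟩ := h1 hy
    refine ⟨x, hmem x hx ?_, hxy⟩
    rwa [hnorm x hx s hs z (mem_sphere_zero_iff_norm.1 hz) hxy]
  have hne : (Sh ∩ G '' U).Nonempty := by
    refine ⟨G q, ⟨(ρ q - c, (1 + (ρ q - c))⁻¹ • G q), ⟨hqJ, ?_⟩, ?_⟩, q, hmem q hq hqJ, rfl⟩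
    all_goals have h2 : 0 < 1 + (ρ q - c) := by linarith [(abs_lt.1 (hJδ _ hqJ).2).1]
    · rw [mem_sphere_zero_iff_norm, norm_smul, h.norm_eq q hq, norm_inv,
        Real.norm_of_nonneg h2.le, inv_mul_cancel₀ h2.ne']
    · simp only [smul_smul]
      rw [mul_inv_cancel₀ h2.ne', one_smul]
  obtain ⟨x, hx, hxz⟩ := hSh.subset_of_closure_inter_subset hPo hne hcl
    ⟨(s, z), ⟨hs, mem_sphere_zero_iff_norm.2 hz⟩, rfl⟩
  exact ⟨x, hx.1, hx.2, hxz⟩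

theorem isSlicing_polar [IsManifold (𝓡∂ 3) ∞ M] (h : IsCollar ι ρ c V G) {Θ : E3 → M}
    (hΘ : ∀ q ∈ interior V, q ∉ range ι → IsLocalInverse G q Θ) {t : ℝ} (ht : 0 < 1 + t)
    (hfull : ∀ z : E3, ‖z‖ = 1 → ∃ x ∈ interior V, x ∉ range ι ∧ G x = (1 + t) • z)
    {ε : ℝ} (hε : ε ^ 2 = 1) :
    IsSlicing ρ (fun w => Θ ((1 + w.2) • stereoInv ε w.1)) t c := by
  let Φ : (ℝ × ℝ) × ℝ → E3 := fun w => (1 + w.2) • stereoInv ε w.1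
  have hΦ : ContDiff ℝ ∞ Φ := (contDiff_const.add contDiff_snd).smul
    ((contDiff_stereoInv ε).comp contDiff_fst)
  have hloc : ∀ u, ∃ x ∈ interior V, G x = Φ (u, t) ∧ IsLocalInverse G x Θ := fun u => by
    obtain ⟨x, hx, hxι, hGx⟩ := hfull _ (norm_stereoInv hε u)
    exact ⟨x, hx, hGx, hΘ x hx hxι⟩
  have hsm : ∀ u, ContMDiffAt 𝓘(ℝ, (ℝ × ℝ) × ℝ) (𝓡∂ 3) ∞ (Θ ∘ Φ) (u, t) := fun u => by
    obtain ⟨x, -, hGx, hx⟩ := hloc u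
    refine ContMDiffAt.comp (u, t) ?_ hΦ.contDiffAt.contMDiffAt
    rw [← hGx]
    exact hx.contMDiffAt
  have hright : ∀ u, ∀ᶠ w in 𝓝 (u, t), Θ (Φ w) ∈ V ∧ G (Θ (Φ w)) = Φ w := fun u => by
    obtain ⟨x, hxV, hGx, hx⟩ := hloc u
    have h1 : Tendsto Φ (𝓝 (u, t)) (𝓝 (G x)) := by
      rw [hGx]
      exact hΦ.continuous.continuousAt
    exact h1.eventually ((hx.tendsto.eventually (mem_interior_iff_mem_nhds.1 hxV)).and
      hx.right_inv)
  refine ⟨hsm, fun u => ?_, fun u => ?_⟩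
  · have h1 : ∀ᶠ w : (ℝ × ℝ) × ℝ in 𝓝 (u, t), 0 < 1 + w.2 :=
      (continuous_const.add continuous_snd).continuousAt.eventually (lt_mem_nhds ht)
    filter_upwards [hright u, h1] with w ⟨hwV, hw⟩ hw1
    have h2 := h.norm_eq _ hwV
    rw [hw, norm_smul, norm_stereoInv hε, mul_one, Real.norm_of_nonneg hw1.le] at h2
    change ρ (Θ (Φ w)) = w.2 + c
    linarith
  · obtain ⟨x, -, hGx, hx⟩ := hloc u
    have hxu : (Θ ∘ Φ) (u, t) = x := by
      simp only [Function.comp_apply]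
      rw [← hGx, hx.left_inv.self_of_nhds]
    have hGd : MDifferentiableAt (𝓡∂ 3) 𝓘(ℝ, E3) G ((Θ ∘ Φ) (u, t)) := by
      rw [hxu]
      exact hx.mdifferentiableAt
    have h1 : G ∘ (Θ ∘ Φ) =ᶠ[𝓝 (u, t)] Φ := (hright u).mono fun w hw => hw.2
    have h2 : ∀ v, mfderiv (𝓡∂ 3) 𝓘(ℝ, E3) G ((Θ ∘ Φ) (u, t))
        (mfderiv 𝓘(ℝ, (ℝ × ℝ) × ℝ) (𝓡∂ 3) (Θ ∘ Φ) (u, t) v) = fderiv ℝ Φ (u, t) v := fun v => by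
      refine (mfderiv_comp_apply (u, t) hGd ((hsm u).mdifferentiableAt (by simp)) v).symm.trans ?_
      rw [mfderiv_eq_fderiv, h1.fderiv_eq]
      rfl
    intro v v' hv
    refine injective_fderiv_polar (u := u) hε ht ?_
    refine (h2 v).symm.trans (Eq.trans ?_ (h2 v'))
    exact congrArg _ hv

end Shell

/-! ### Vanishing off the level set, and continuity -/

section Main
open Set Filter Topology

variable {M : Type*} [TopologicalSpace M] [ChartedSpace (EuclideanHalfSpace 3) M]
  [IsManifold (𝓡∂ 3) ∞ M] {g : RiemMetric M} {o : MfdOrientation M} {B : ∀ x : M, T x}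
  {ι : S2 → M} {ρ : M → ℝ} {c : ℝ} {V : Set M} {G : M → E3}

theorem IsCollar.eq_zero_of_ne [T2Space M] (h : IsCollar ι ρ c V G) (hρι : ∀ w, ρ (ι w) = c)
    (hB : IsSmoothField B) (hdiv : ∀ x : M, divergence g o B x = 0)
    (hρ : ContMDiff (𝓡∂ 3) 𝓘(ℝ, ℝ) ∞ ρ) (hρB : IsFirstIntegral ρ B)
    (hcurl : IsFirstIntegral ρ (curl g o B))
    {δ : ℝ} (hδ1 : δ ≤ 1) (hδ : ∀ q ∈ frontier V, δ ≤ |ρ q - c|) {q : M} (hq : q ∈ interior V)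
    (hqc : ρ q ≠ c) (hqδ : |ρ q - c| < δ) : B q = 0 := by
  obtain ⟨Θ, hΘ⟩ := h.exists_inverse
  have hqV := interior_subset hq
  -- Only the side of `S` containing `q` is used: when `S` lies in the boundary, the other side may
  -- be absent.
  obtain ⟨J, hJ, hJδ, hqJ⟩ : ∃ J : Set ℝ, IsPreconnected J ∧ (∀ s ∈ J, s ≠ 0 ∧ |s| < δ) ∧
      ρ q - c ∈ J := by
    rw [abs_lt] at hqδ
    rcases lt_or_gt_of_ne (sub_ne_zero.2 hqc) with h0 | h0
    · exact ⟨Ioo (-δ) 0, isPreconnected_Ioo, fun s hs => ⟨hs.2.ne, by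
        rw [abs_of_neg hs.2]
        linarith [hs.1]⟩, hqδ.1, h0⟩
    · exact ⟨Ioo 0 δ, isPreconnected_Ioo, fun s hs => ⟨hs.1.ne', by
        rw [abs_of_pos hs.1]
        exact hs.2⟩, h0, hqδ.2⟩
  have ht : 0 < 1 + (ρ q - c) := by linarith [(abs_lt.1 hqδ).1]
  have hfull : ∀ z : E3, ‖z‖ = 1 →
      ∃ x ∈ interior V, x ∉ range ι ∧ G x = (1 + (ρ q - c)) • z := fun z hz =>
    h.exists_eq_smul hρι hρ.continuous hδ1 hδ hJ hJδ hqV hqJ hqJ hz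
  have h1 := isSlicing_polar h hΘ ht hfull (ε := 1) (by norm_num)
  have h2 := isSlicing_polar h hΘ ht hfull (ε := -1) (by norm_num)
  have hqι : q ∉ range ι := by
    rintro ⟨w, rfl⟩
    exact hqc (hρι w)
  have hz : ‖(1 + (ρ q - c))⁻¹ • G q‖ = 1 := by
    rw [norm_smul, h.norm_eq q hqV, norm_inv, Real.norm_of_nonneg ht.le, inv_mul_cancel₀ ht.ne']
  have hqΘ : ∀ z : E3, z = (1 + (ρ q - c))⁻¹ • G q → Θ ((1 + (ρ q - c)) • z) = q := by
    rintro _ rfl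
    rw [smul_smul, mul_inv_cancel₀ ht.ne', one_smul]
    exact (hΘ q hq hqι).left_inv.self_of_nhds
  rcases exists_stereoInv_eq hz with ⟨u, hu⟩ | ⟨u, hu⟩
  · have h3 := h1.eq_zero_of_glue h2 (fun u hu s => by
      simp only [stereoInv_planeInv hu 1]) hB hdiv hρ hρB hcurl u
    rw [← hqΘ _ hu]
    exact h3
  · have h3 := h2.eq_zero_of_glue h1 (fun u hu s => by
      simp only [stereoInv_planeInv hu (-1), neg_neg]) hB hdiv hρ hρB hcurl u
    rw [← hqΘ _ hu]
    exact h3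

/-- The set where a smooth vector field does not vanish is open. -/
theorem eventually_ne_zero (hB : IsSmoothField B) {q : M} (hq : B q ≠ 0) :
    ∀ᶠ x in 𝓝 q, B x ≠ 0 := by
  let e := trivializationAt E3 (TangentSpace (𝓡∂ 3)) q
  have hqe : q ∈ e.baseSet := FiberBundle.mem_baseSet_trivializationAt E3 _ q
  have h1 : ContinuousAt (fun x => (e ⟨x, B x⟩).2) q :=
    ((e.contMDiffAt_section_iff hqe).1 (hB q)).continuousAt
  have h2 : ∀ x ∈ e.baseSet, (e ⟨x, B x⟩).2 = e.linearMapAt ℝ x (B x) := fun x hx => by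
    rw [e.linearMapAt_apply, if_pos hx]
  have h3 : (e ⟨q, B q⟩).2 ≠ 0 := by
    rw [h2 q hqe]
    intro h0
    exact hq (by rw [← e.symmₗ_linearMapAt (R := ℝ) hqe (B q), h0, map_zero])
  filter_upwards [h1.eventually_ne h3, e.open_baseSet.mem_nhds hqe] with x hx hxe h0
  rw [h2 x hxe, h0, map_zero] at hx
  exact hx rfl

end Main
end Riem3

theorem corollary3 {M : Type*} [TopologicalSpace M] [T2Space M] [SecondCountableTopology M]
    [ChartedSpace (EuclideanHalfSpace 3) M] [IsManifold (𝓡∂ 3) ∞ M]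
    (g : Riem3.RiemMetric M) (o : Riem3.MfdOrientation M)
    (B : ∀ x : M, Riem3.T x) (hB : Riem3.IsSmoothField B)
    (hdiv : ∀ x : M, Riem3.divergence g o B x = 0)
    (ρ : M → ℝ) (hρ : ContMDiff (𝓡∂ 3) 𝓘(ℝ, ℝ) ∞ ρ)
    (hρB : Riem3.IsFirstIntegral ρ B)
    (hρcurl : Riem3.IsFirstIntegral ρ (Riem3.curl g o B))
    (c : ℝ) (hc : Riem3.IsRegularValue ρ c)
    (x₀ : M) (hx₀ : ρ x₀ = c)
    (S : Set M) (hS : S = connectedComponentIn (ρ ⁻¹' {c}) x₀)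
    (hsphere : Riem3.IsEmbeddedSphere S)
    (hbdry : S ∩ (𝓡∂ 3).boundary M = ∅ ∨ S ⊆ (𝓡∂ 3).boundary M) :
    ∃ U : Set M, IsOpen U ∧ S ⊆ U ∧ ∀ x ∈ U, B x = 0 := by
  obtain ⟨ι, hι, hemb, hinj, hιS⟩ := hsphere
  have hρι : ∀ w, ρ (ι w) = c := fun w => by
    have h1 : ι w ∈ connectedComponentIn (ρ ⁻¹' {c}) x₀ := hS ▸ hιS ▸ Set.mem_range_self w
    have h2 : ι w ∈ ρ ⁻¹' {c} := connectedComponentIn_subset _ _ h1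
    exact h2
  subst hιS
  obtain ⟨V, G, hV⟩ := Riem3.exists_isCollar hι hemb hinj hρ hρι hc hbdry
  -- Inside `V` the level set is just `S`, which lies in the interior; compactness of the frontier
  -- then yields the uniform gap `δ₀`.
  have hfr : ∀ q ∈ frontier V, 0 < |ρ q - c| := fun q hq => by
    rw [abs_pos, sub_ne_zero]
    intro hqc
    exact hq.2 (hV.subset_interior (hV.mem_range_of_eq (hV.isCompact.isClosed.frontier_subset hq)
      hqc))
  obtain ⟨δ₀, hδ₀, hδ⟩ := (hV.isCompact.of_isClosed_subset isClosed_frontier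
    hV.isCompact.isClosed.frontier_subset).exists_forall_le'
      (hρ.continuous.sub continuous_const).abs.continuousOn hfr
  -- The cap at `1` keeps the radii `1 + s` positive.
  have hδ' : ∀ q ∈ frontier V, min δ₀ 1 ≤ |ρ q - c| := fun q hq =>
    (min_le_left _ _).trans (hδ q hq)
  refine ⟨interior V ∩ {q | |ρ q - c| < min δ₀ 1}, isOpen_interior.inter
    (isOpen_lt (hρ.continuous.sub continuous_const).abs continuous_const), ?_, ?_⟩
  · rintro _ ⟨w, rfl⟩
    refine ⟨hV.subset_interior (Set.mem_range_self w), ?_⟩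
    change |ρ (ι w) - c| < min δ₀ 1
    rw [hρι, sub_self, abs_zero]
    exact lt_min hδ₀ one_pos
  · rintro q ⟨hq, hqδ⟩
    have hoff : ∀ x ∈ interior V ∩ {q | |ρ q - c| < min δ₀ 1}, ρ x ≠ c → B x = 0 := fun x hx hxc =>
      hV.eq_zero_of_ne hρι hB hdiv hρ hρB hρcurl (min_le_right _ _) hδ' hx.1 hxc hx.2
    by_cases hqc : ρ q = c
    · by_contra hBq
      -- If `B q ≠ 0`, then `B` has no zeros near `q`; as it vanishes off the level set, `ρ` equals
      -- `c` near `q`, contradicting `dρ ≠ 0`.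
      have h1 : ρ =ᶠ[𝓝 q] fun _ => c := by
        filter_upwards [Riem3.eventually_ne_zero hB hBq, (isOpen_interior.inter
          (isOpen_lt (hρ.continuous.sub continuous_const).abs continuous_const)).mem_nhds
            ⟨hq, hqδ⟩] with x hx hxU
        by_contra hxc
        exact hx (hoff x hxU hxc)
      refine hc q hqc ?_
      rw [h1.mfderiv_eq, mfderiv_const]
      rfl
    · exact hoff q ⟨hq, hqδ⟩ hqc
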